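/- Let $N\ge 1$ and $p=p_F:=1+\frac2N$. For $0<\alpha<1$ let $h_\alpha$ be the probability density on $(0,\infty)$ (the M-Wright function) that is continuous and positive and satisfies $\int_0^\infty h_\alpha(\theta)e^{z\theta}\,d\theta=E_{\alpha,1}(z):=\sum_{k\ge0}\frac{z^k}{\Gamma(\alpha k+1)}$ for all $z\in\mathbb C$. For a nonnegative Borel measure $\mu$ on $\mathbb R^N$ put $e^{t\Delta}\mu(x)=\int_{\mathbb R^N}(4\pi t)^{-N/2}e^{-|x-y|^2/(4t)}\,d\mu(y)$ and $$P_\alpha(t)\mu=\int_0^\infty h_\alpha(\theta)\,e^{t^\alpha\theta\Delta}\mu\,d\theta,\qquad S_\alpha(t)\mu=\int_0^\infty\theta h_\alpha(\theta)\,e^{t^\alpha\theta\Delta}\mu\,d\theta ,$$ where a nonnegative function $f$ is identified with the measure $f\,dx$. For a nonnegative finite measure $\mu$ on $\mathbb R^N$ and $0<T<\infty$, a nonnegative measurable function $u$ on $(0,T]\times\mathbb R^N$ is a solution on $[0,T]\times\mathbb R^N$ of $$\partial_t^\alpha u-\Delta u=u^p,\qquad u(0)=\mu \qquad (\partial_t^\alpha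 \text{ the Caputo derivative})$$ if $$\infty>u(t,x)=[P_\alpha(t)\mu](x)+\alpha\int_0^t(t-s)^{\alpha-1}[S_\alpha(t-s)u(s)^p](x)\,ds$$ for almost all $t\in(0,T]$ and $x\in\mathbb R^N$. A global-in-time solution is a function on $(0,\infty)\times\mathbb R^N$ that is a solution on $[0,T]\times\mathbb R^N$ for every $T>0$. Let $\mathcal G_\alpha$ be the set of nonnegative finite measures $\nu$ on $\mathbb R^N$ such that the problem with $u(0)=\nu$ possesses a global-in-time solution, and for $r>0$ let $\mathcal B^+(r)$ be the set of nonnegative measures on $\mathbb R^N$ of total mass at most $r$. Theorem. There exist constants $0<C_1\le C_2$, depending only on $N$, and $\alpha_0\in(0,1)$ such that for all $\alpha\in(\alpha_0,1)$ $$\mathcal B^+\big(C_1(1-\alpha)^{N/2}\big)\subset\mathcal G_\alpha\subset\mathcal B^+\big(C_2(1-\alpha)^{N/2}\big).$$ In particular, for all $\alpha\in(\alpha_0,1)$ $$C_1(1-\alpha)^{N/2}\le\sup_{\nu\in\mathcal G_\alpha}\nu(\mathbb R^N)\le C_2(1-\alpha)^{N/2},$$ and $\displaystyle\lim_{\alpha\to1^-}\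 \sup_{\nu\in\mathcal G_\alpha}\nu(\mathbb R^N)=0$. -/

import Mathlib

open MeasureTheory Set Filter Topology
open scoped ENNReal

namespace TimeFracHeat

/-- The Mittag-Leffler function `E_{a,b}(z) = ∑ zᵏ / Γ(a k + b)`. -/
noncomputable def mittagLeffler (a b : ℝ) (z : ℂ) : ℂ :=
  ∑' k : ℕ, z ^ k / Complex.Gamma ((a : ℂ) * k + b)

/-- The angular kernel in the Mikusinski-Zolotarev integral representation of positive stable
densities. -/
noncomputable def zolotarevKernel (α φ : ℝ) : ℝ :=
  Real.sin ((1 - α) * φ) * Real.sin (α * φ) ^ (α / (1 - α)) / Real.sin φ ^ (1 / (1 - α))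

/-- The probability density `h_α` on `(0, ∞)` of the time-fractional subordination formula (the
M-Wright, or Mainardi, function), written through its integral representation, for `0 < α < 1`.
It is the density with `∫ h_α(θ) e^{zθ} dθ = E_{α,1}(z)` for all `z ∈ ℂ`: this, together with
`h_α > 0` and `∫ h_α = 1`, is proved below. -/
noncomputable def wrightDensity (α θ : ℝ) : ℝ :=
  θ ^ (α / (1 - α)) / (Real.pi * (1 - α)) *
    ∫ φ in Ioo 0 Real.pi, zolotarevKernel α φ * Real.exp (-zolotarevKernel α φ * θ ^ (1 / (1 - α)))

theorem sum_choose_sinc (n : ℕ) : ∀ x : ℝ,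
    ∑ k ∈ Finset.range (n + 1), (n.choose k : ℝ) * Real.sinc (((k : ℝ) - x) * Real.pi)
      = (Real.Gamma (n + 1)) * ((Real.Gamma (1 + x))⁻¹ * (Real.Gamma (1 + n - x))⁻¹) := by
  have hrec : ∀ s : ℝ, (Real.Gamma s)⁻¹ = s * (Real.Gamma (s + 1))⁻¹ := by
    intro s
    rcases eq_or_ne s 0 with rfl | hs
    · simp [Real.Gamma_zero]
    · rw [Real.Gamma_add_one hs, mul_inv, ← mul_assoc, mul_inv_cancel₀ hs, one_mul]
  induction n with
  | zero =>
    intro x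
    have hp := Real.pi_ne_zero
    rcases eq_or_ne x 0 with rfl | hx
    · simp
    · have h1 := Real.Gamma_mul_Gamma_one_sub x
      simp only [zero_add, Finset.range_one, Finset.sum_singleton, Nat.choose_self, Nat.cast_one,
        one_mul, Nat.cast_zero, Real.Gamma_one, add_zero, zero_sub, neg_mul, Real.sinc_neg]
      rw [Real.sinc_of_ne_zero (mul_ne_zero hx hp), add_comm 1 x, Real.Gamma_add_one hx,
        ← mul_inv, mul_assoc, h1, mul_comm Real.pi x, ← mul_div_assoc, inv_div]
  | succ n ih =>
    intro x
    have hx := ih x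
    have hx' := ih (x - 1)
    have e1 : ∑ k ∈ Finset.range (n + 1 + 1), ((n + 1).choose k : ℝ) *
          Real.sinc (((k : ℝ) - x) * Real.pi)
        = (∑ k ∈ Finset.range (n + 1), (n.choose k : ℝ) * Real.sinc (((k : ℝ) - x) * Real.pi))
        + ∑ k ∈ Finset.range (n + 1), (n.choose k : ℝ) *
          Real.sinc (((k : ℝ) - (x - 1)) * Real.pi) := by
      rw [Finset.sum_range_succ']
      simp only [Nat.choose_succ_succ, Nat.cast_add, add_mul, Finset.sum_add_distrib]
      rw [Finset.sum_range_succ (fun k : ℕ => ((n.choose (k + 1) : ℕ) : ℝ) * _),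
        Finset.sum_range_succ' (fun k : ℕ => ((n.choose k : ℕ) : ℝ) *
          Real.sinc (((k : ℝ) - x) * Real.pi))]
      simp [sub_sub_eq_add_sub, add_sub_right_comm]
      ring
    rw [e1, hx, hx']
    push_cast
    have h1 := hrec x
    have h2 := hrec (1 + n - x)
    have h3 : Real.Gamma ((n : ℝ) + 1 + 1) = (n + 1) * Real.Gamma (n + 1) :=
      Real.Gamma_add_one (by positivity)
    rw [h3, show (1 : ℝ) + (x - 1) = x by ring, show (1 : ℝ) + n - (x - 1) = 1 + n - x + 1 by ring,
      show (1 : ℝ) + (n + 1) - x = 1 + n - x + 1 by ring, h1, h2, add_comm x 1]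
    ring

/-- The angular integral that gives the integer moments of the Wright density. -/
theorem integral_kernel_pow {α : ℝ} (h0 : 0 < α) (h1 : α < 1) (n : ℕ) :
    IntervalIntegrable (fun φ : ℝ => (Real.sin φ ^ n /
        (Real.sin ((1 - α) * φ) ^ ((1 - α) * n) * Real.sin (α * φ) ^ (α * n)))) volume 0 Real.pi ∧
    ∫ φ in (0 : ℝ)..Real.pi, (Real.sin φ ^ n /
        (Real.sin ((1 - α) * φ) ^ ((1 - α) * n) * Real.sin (α * φ) ^ (α * n)))
      = Real.pi * (Real.Gamma (n + 1) *
        ((Real.Gamma (1 + α * n))⁻¹ * (Real.Gamma (1 + (1 - α) * n))⁻¹)) := by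
  have hpi := Real.pi_pos
  have hβ : 0 < 1 - α := by linarith
  set D : ℝ → ℝ := fun φ => (Real.sin φ ^ n /
        (Real.sin ((1 - α) * φ) ^ ((1 - α) * n) * Real.sin (α * φ) ^ (α * n))) with hD
  set r : ℝ → ℝ := fun φ => α * Real.sinc (α * φ) / ((1 - α) * Real.sinc ((1 - α) * φ)) with hr
  set F : ℝ → ℝ := fun φ => ∑ k ∈ Finset.range (n + 1), (n.choose k : ℝ) *
    (r φ ^ ((k : ℝ) - α * n) * (φ * Real.sinc (((k : ℝ) - α * n) * φ))) with hF
  have spos : ∀ c : ℝ, 0 < c → c < 1 → ∀ φ ∈ Icc 0 Real.pi, 0 < Real.sinc (c * φ) := by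
    intro c hc hc1 φ hφ
    rcases eq_or_lt_of_le hφ.1 with h | h
    · simp [← h]
    · rw [Real.sinc_of_ne_zero (by positivity)]
      refine div_pos (Real.sin_pos_of_pos_of_lt_pi (by positivity) ?_) (by positivity)
      nlinarith [hφ.2]
  have rpos : ∀ φ ∈ Icc 0 Real.pi, 0 < r φ := by
    intro φ hφ
    have := spos α h0 h1 φ hφ
    have := spos (1 - α) hβ (by linarith) φ hφ
    simp only [hr]; positivity
  have hFc : ContinuousOn F (Icc 0 Real.pi) := by
    have cr : ContinuousOn r (Icc 0 Real.pi) := by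
      refine ContinuousOn.div (Continuous.continuousOn ?_) (Continuous.continuousOn ?_) ?_
      · exact continuous_const.mul (Real.continuous_sinc.comp (by fun_prop))
      · exact continuous_const.mul (Real.continuous_sinc.comp (by fun_prop))
      · intro φ hφ
        exact (mul_pos hβ (spos (1 - α) hβ (by linarith) φ hφ)).ne'
    refine continuousOn_finsetSum _ fun k _ => ?_
    refine ContinuousOn.mul continuousOn_const (ContinuousOn.mul
      (cr.rpow_const fun φ hφ => Or.inl (rpos φ hφ).ne') (Continuous.continuousOn ?_))
    exact continuous_id.mul (Real.continuous_sinc.comp (by fun_prop))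
  have hDnn : ∀ φ ∈ Ioo 0 Real.pi, 0 ≤ D φ := by
    intro φ hφ
    have s1 : 0 < Real.sin φ := Real.sin_pos_of_pos_of_lt_pi hφ.1 hφ.2
    have s2 : 0 < Real.sin (α * φ) :=
      Real.sin_pos_of_pos_of_lt_pi (mul_pos h0 hφ.1) (by nlinarith [hφ.2, hφ.1])
    have s3 : 0 < Real.sin ((1 - α) * φ) :=
      Real.sin_pos_of_pos_of_lt_pi (mul_pos hβ hφ.1) (by nlinarith [hφ.2, hφ.1])
    simp only [hD]; positivity
  have hderiv : ∀ φ ∈ Ioo 0 Real.pi, HasDerivAt F (D φ) φ := by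
    intro φ hφ
    have s1 : 0 < Real.sin φ := Real.sin_pos_of_pos_of_lt_pi hφ.1 hφ.2
    have s2 : 0 < Real.sin (α * φ) :=
      Real.sin_pos_of_pos_of_lt_pi (mul_pos h0 hφ.1) (by nlinarith [hφ.2, hφ.1])
    have s3 : 0 < Real.sin ((1 - α) * φ) :=
      Real.sin_pos_of_pos_of_lt_pi (mul_pos hβ hφ.1) (by nlinarith [hφ.2, hφ.1])
    have req : ∀ ψ ∈ Ioo 0 Real.pi, r ψ = Real.sin (α * ψ) / Real.sin ((1 - α) * ψ) := by
      intro ψ hψ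
      have hne := hψ.1.ne'
      have hb' := hβ.ne'
      simp only [hr]
      rw [Real.sinc_of_ne_zero (mul_ne_zero h0.ne' hne),
        Real.sinc_of_ne_zero (mul_ne_zero hb' hne)]
      field_simp
    obtain ⟨ρ, hρ⟩ : ∃ ρ : ℝ, HasDerivAt r (ρ * r φ) φ := by
      have hdiff : DifferentiableAt ℝ (fun ψ => Real.sin (α * ψ) / Real.sin ((1 - α) * ψ)) φ :=
        DifferentiableAt.fun_div (by fun_prop) (by fun_prop) s3.ne'
      have heq : r =ᶠ[𝓝 φ] fun ψ => Real.sin (α * ψ) / Real.sin ((1 - α) * ψ) :=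
        Filter.eventuallyEq_of_mem (Ioo_mem_nhds hφ.1 hφ.2) req
      refine ⟨deriv r φ / r φ, ?_⟩
      rw [div_mul_cancel₀ _ (rpos φ ⟨hφ.1.le, hφ.2.le⟩).ne']
      exact (hdiff.congr_of_eventuallyEq heq).hasDerivAt
    have hrp := rpos φ ⟨hφ.1.le, hφ.2.le⟩
    have hs : ∀ c : ℝ, HasDerivAt (fun ψ => ψ * Real.sinc (c * ψ)) (Real.cos (c * φ)) φ := by
      intro c
      rcases eq_or_ne c 0 with rfl | hc
      · simp only [zero_mul, Real.sinc_zero, mul_one, Real.cos_zero]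
        exact hasDerivAt_id' φ
      · have : HasDerivAt (fun ψ => Real.sin (c * ψ) / c) (Real.cos (c * φ)) φ := by
          have h := (((hasDerivAt_id' φ).const_mul c).sin).div_const c
          rwa [mul_one, mul_div_cancel_right₀ _ hc] at h
        refine this.congr_of_eventuallyEq
          (Filter.eventuallyEq_of_mem (Ioi_mem_nhds hφ.1) fun ψ hψ => ?_)
        have : ψ ≠ 0 := (mem_Ioi.mp hψ).ne'
        show ψ * Real.sinc (c * ψ) = Real.sin (c * ψ) / c
        rw [Real.sinc_of_ne_zero (mul_ne_zero hc this)]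
        field_simp
    have hsv : ∀ c : ℝ, c * (φ * Real.sinc (c * φ)) = Real.sin (c * φ) := by
      intro c
      rcases eq_or_ne c 0 with rfl | hc
      · simp
      · have := hφ.1.ne'
        rw [Real.sinc_of_ne_zero (mul_ne_zero hc this)]
        field_simp
    have hd : HasDerivAt F (∑ k ∈ Finset.range (n + 1), (n.choose k : ℝ) *
        ((ρ * r φ) * ((k : ℝ) - α * n) * r φ ^ ((k : ℝ) - α * n - 1) *
            (φ * Real.sinc (((k : ℝ) - α * n) * φ))
          + r φ ^ ((k : ℝ) - α * n) * Real.cos (((k : ℝ) - α * n) * φ))) φ := by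
      refine HasDerivAt.fun_sum fun k _ => HasDerivAt.const_mul _ ?_
      exact (hρ.rpow_const (Or.inl hrp.ne')).mul (hs _)
    convert hd using 1
    set x := α * n with hx
    have hterm : ∀ k ∈ Finset.range (n + 1), (n.choose k : ℝ) *
        ((ρ * r φ) * ((k : ℝ) - x) * r φ ^ ((k : ℝ) - x - 1) *
            (φ * Real.sinc (((k : ℝ) - x) * φ))
          + r φ ^ ((k : ℝ) - x) * Real.cos (((k : ℝ) - x) * φ))
        = r φ ^ (-x) * (ρ * ((n.choose k : ℝ) * r φ ^ k * Real.sin (((k : ℝ) - x) * φ))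
          + (n.choose k : ℝ) * r φ ^ k * Real.cos (((k : ℝ) - x) * φ)) := by
      intro k _
      have e1 : r φ ^ ((k : ℝ) - x - 1) = r φ ^ (-x) * r φ ^ k / r φ := by
        rw [Real.rpow_sub_one hrp.ne', sub_eq_neg_add, Real.rpow_add hrp, Real.rpow_natCast]
      have e2 : r φ ^ ((k : ℝ) - x) = r φ ^ (-x) * r φ ^ k := by
        rw [sub_eq_neg_add, Real.rpow_add hrp, Real.rpow_natCast]
      rw [e1, e2, ← hsv]
      field_simp
    rw [Finset.sum_congr rfl hterm, ← Finset.mul_sum, Finset.sum_add_distrib, ← Finset.mul_sum]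
    have hc : ∑ k ∈ Finset.range (n + 1), ((n.choose k : ℝ) * r φ ^ k : ℝ) *
        Complex.exp ((((k : ℝ) - x) * φ : ℝ) * Complex.I)
        = (((Real.sin φ / Real.sin ((1 - α) * φ)) ^ n : ℝ) : ℂ) := by
      have h1e : (1 : ℂ) + (r φ : ℂ) * Complex.exp (φ * Complex.I)
          = ((Real.sin φ / Real.sin ((1 - α) * φ) : ℝ) : ℂ) *
            Complex.exp ((α * φ : ℝ) * Complex.I) := by
        have hsplit : φ = (1 - α) * φ + α * φ := by ring
        rw [req φ hφ, Complex.exp_mul_I, Complex.exp_mul_I, ← Complex.ofReal_cos,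
          ← Complex.ofReal_sin, ← Complex.ofReal_cos, ← Complex.ofReal_sin]
        have key1 : 1 + Real.sin (α * φ) / Real.sin ((1 - α) * φ) * Real.cos φ
            = Real.sin φ / Real.sin ((1 - α) * φ) * Real.cos (α * φ) := by
          have : Real.sin ((1 - α) * φ) = Real.sin φ * Real.cos (α * φ)
              - Real.cos φ * Real.sin (α * φ) := by
            rw [← Real.sin_sub]; congr 1; ring
          have hne := s3.ne'
          rw [div_mul_eq_mul_div, div_mul_eq_mul_div, eq_div_iff hne, add_mul,
            div_mul_cancel₀ _ hne, this]
          ring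
        have key2 : Real.sin (α * φ) / Real.sin ((1 - α) * φ) * Real.sin φ
            = Real.sin φ / Real.sin ((1 - α) * φ) * Real.sin (α * φ) := by ring
        apply Complex.ext
        · simpa [-Complex.ofReal_div, -Complex.ofReal_sin, -Complex.ofReal_cos] using key1
        · simpa [-Complex.ofReal_div, -Complex.ofReal_sin, -Complex.ofReal_cos] using key2
      have h2e : ((1 : ℂ) + (r φ : ℂ) * Complex.exp (φ * Complex.I)) ^ n
          = ∑ k ∈ Finset.range (n + 1), ((n.choose k : ℝ) * r φ ^ k : ℝ) *
            Complex.exp ((((k : ℝ)) * φ : ℝ) * Complex.I) := by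
        rw [add_comm, add_pow]
        refine Finset.sum_congr rfl fun k _ => ?_
        rw [mul_pow, ← Complex.exp_nat_mul]
        push_cast
        rw [one_pow]
        ring_nf
      have h3e : ∑ k ∈ Finset.range (n + 1), ((n.choose k : ℝ) * r φ ^ k : ℝ) *
            Complex.exp ((((k : ℝ) - x) * φ : ℝ) * Complex.I)
          = ((1 : ℂ) + (r φ : ℂ) * Complex.exp (φ * Complex.I)) ^ n *
            Complex.exp (-(x * φ : ℝ) * Complex.I) := by
        rw [h2e, Finset.sum_mul]
        refine Finset.sum_congr rfl fun k _ => ?_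
        rw [mul_assoc, ← Complex.exp_add]
        congr 2
        push_cast; ring
      rw [h3e, h1e, mul_pow, ← Complex.exp_nat_mul, mul_assoc, ← Complex.exp_add]
      have : (n : ℂ) * ((α * φ : ℝ) * Complex.I) + -(x * φ : ℝ) * Complex.I = 0 := by
        rw [hx]; push_cast; ring
      rw [this, Complex.exp_zero, mul_one]
      push_cast; rfl
    have him := congrArg Complex.im hc
    have hre := congrArg Complex.re hc
    simp only [Complex.im_sum, Complex.re_sum, Complex.re_ofReal_mul, Complex.im_ofReal_mul,
      Complex.exp_ofReal_mul_I_re, Complex.exp_ofReal_mul_I_im, Complex.ofReal_re,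
      Complex.ofReal_im] at him hre
    rw [him, hre, mul_zero, zero_add, req φ hφ]
    simp only [hD]
    rw [Real.rpow_neg (by positivity), Real.div_rpow s2.le s3.le, div_pow,
      show (1 - α) * n = n - x by rw [hx]; ring, Real.rpow_sub s3, Real.rpow_natCast]
    field_simp
  have hint : IntervalIntegrable D volume 0 Real.pi := by
    rw [intervalIntegrable_iff_integrableOn_Ioc_of_le hpi.le]
    exact intervalIntegral.integrableOn_deriv_of_nonneg hFc hderiv hDnn
  refine ⟨hint, ?_⟩
  rw [intervalIntegral.integral_eq_sub_of_hasDerivAt_of_le hpi.le hFc hderiv hint]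
  have hF0 : F 0 = 0 := by simp [hF]
  have hrpi : r Real.pi = 1 := by
    have e := Real.sin_pi_sub (α * Real.pi)
    have : (1 - α) * Real.pi = Real.pi - α * Real.pi := by ring
    have hpos : 0 < Real.sin (α * Real.pi) :=
      Real.sin_pos_of_pos_of_lt_pi (by positivity) (by nlinarith)
    simp only [hr]
    rw [Real.sinc_of_ne_zero (by positivity), Real.sinc_of_ne_zero (by positivity), this, e]
    have : Real.pi - α * Real.pi ≠ 0 := by nlinarith
    field_simp
  have := sum_choose_sinc n (α * n)
  rw [hF0, sub_zero, show (1 : ℝ) + (1 - α) * n = 1 + n - α * n by ring, ← this]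
  simp only [hF, hrpi, Real.one_rpow, one_mul]
  rw [Finset.mul_sum]
  exact Finset.sum_congr rfl fun k _ => by ring

/-- The kernel is positive on `(0, π)`. -/
theorem zolotarevKernel_pos {α φ : ℝ} (h0 : 0 < α) (h1 : α < 1) (hφ : φ ∈ Ioo 0 Real.pi) :
    0 < zolotarevKernel α φ := by
  have hβ : 0 < 1 - α := by linarith
  have s1 : 0 < Real.sin φ := Real.sin_pos_of_pos_of_lt_pi hφ.1 hφ.2
  have s2 : 0 < Real.sin (α * φ) :=
    Real.sin_pos_of_pos_of_lt_pi (mul_pos h0 hφ.1) (by nlinarith [hφ.2, hφ.1])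
  have s3 : 0 < Real.sin ((1 - α) * φ) :=
    Real.sin_pos_of_pos_of_lt_pi (mul_pos hβ hφ.1) (by nlinarith [hφ.2, hφ.1])
  unfold zolotarevKernel; positivity

theorem measurable_zolotarevKernel (α : ℝ) : Measurable (zolotarevKernel α) := by
  unfold zolotarevKernel; fun_prop

theorem integrable_zolotarevKernel {α c : ℝ} (h0 : 0 < α) (h1 : α < 1) (hc : 0 < c) :
    IntegrableOn (fun φ => zolotarevKernel α φ * Real.exp (-zolotarevKernel α φ * c))
      (Ioo 0 Real.pi) := by
  have hm := measurable_zolotarevKernel α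
  refine Measure.integrableOn_of_bounded (M := 1 / c) (by simp) ?_ ?_
  · exact Measurable.aestronglyMeasurable (by fun_prop)
  · refine (ae_restrict_iff' measurableSet_Ioo).mpr (Eventually.of_forall fun φ hφ => ?_)
    have hk := zolotarevKernel_pos h0 h1 hφ
    rw [Real.norm_of_nonneg (by positivity), neg_mul, Real.exp_neg, ← div_eq_mul_inv,
      div_le_div_iff₀ (Real.exp_pos _) hc]
    linarith [Real.add_one_le_exp (zolotarevKernel α φ * c)]

theorem measurable_wrightDensity (α : ℝ) : Measurable (wrightDensity α) := by
  have hm := measurable_zolotarevKernel α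
  refine Measurable.mul (by fun_prop) (StronglyMeasurable.measurable ?_)
  refine StronglyMeasurable.integral_prod_right (f := fun (θ φ : ℝ) => zolotarevKernel α φ *
    Real.exp (-zolotarevKernel α φ * θ ^ (1 / (1 - α)))) (Measurable.stronglyMeasurable ?_)
  unfold Function.uncurry
  fun_prop

/-- `h_α > 0` on `(0, ∞)`. -/
theorem wrightDensity_pos {α θ : ℝ} (h0 : 0 < α) (h1 : α < 1) (hθ : 0 < θ) :
    0 < wrightDensity α θ := by
  have hβ : 0 < 1 - α := by linarith
  have hpi := Real.pi_pos
  refine mul_pos (by positivity) ?_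
  rw [setIntegral_pos_iff_support_of_nonneg_ae]
  · refine lt_of_lt_of_le ?_ (measure_mono (s := Ioo 0 Real.pi) fun φ hφ => ⟨?_, hφ⟩)
    · simp [hpi]
    · exact (mul_pos (zolotarevKernel_pos h0 h1 hφ) (Real.exp_pos _)).ne'
  · refine (ae_restrict_iff' measurableSet_Ioo).mpr (Eventually.of_forall fun φ hφ => ?_)
    exact (mul_pos (zolotarevKernel_pos h0 h1 hφ) (Real.exp_pos _)).le
  · exact integrable_zolotarevKernel h0 h1 (by positivity)

/-- Integer moments: `∫ θⁿ h_α(θ) dθ = Γ(1 + n) / Γ(1 + α n)`; for `n = 0` this says that `h_α` is a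
probability density. -/
theorem lintegral_wrightDensity_pow {α : ℝ} (h0 : 0 < α) (h1 : α < 1) (n : ℕ) :
    ∫⁻ θ in Ioi (0 : ℝ), ENNReal.ofReal (wrightDensity α θ * θ ^ n)
      = ENNReal.ofReal (Real.Gamma (n + 1) * (Real.Gamma (1 + α * n))⁻¹) := by
  have hβ : 0 < 1 - α := by linarith
  have hpi := Real.pi_pos
  have hm := measurable_zolotarevKernel α
  set f : ℝ → ℝ → ℝ := fun θ φ => θ ^ ((n : ℝ) + α / (1 - α)) *
    Real.exp (-zolotarevKernel α φ * θ ^ (1 / (1 - α))) *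
      (zolotarevKernel α φ / (Real.pi * (1 - α))) with hf
  have e1 : ∀ θ ∈ Ioi (0 : ℝ), ENNReal.ofReal (wrightDensity α θ * θ ^ n)
      = ∫⁻ φ in Ioo 0 Real.pi, ENNReal.ofReal (f θ φ) := by
    intro θ hθ
    have hθ' : 0 < θ := hθ
    have hi := integrable_zolotarevKernel h0 h1 (c := θ ^ (1 / (1 - α))) (by positivity)
    have : ∀ φ, f θ φ = (θ ^ n * (θ ^ (α / (1 - α)) / (Real.pi * (1 - α)))) *
        (zolotarevKernel α φ * Real.exp (-zolotarevKernel α φ * θ ^ (1 / (1 - α)))) := by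
      intro φ
      simp only [hf]
      rw [Real.rpow_add hθ', Real.rpow_natCast]; ring
    simp only [this]
    rw [← ofReal_integral_eq_lintegral_ofReal (hi.const_mul _), integral_const_mul]
    · congr 1; unfold wrightDensity; ring
    · refine (ae_restrict_iff' measurableSet_Ioo).mpr (Eventually.of_forall fun φ hφ => ?_)
      have := zolotarevKernel_pos h0 h1 hφ
      simp only [Pi.zero_apply]; positivity
  rw [setLIntegral_congr_fun measurableSet_Ioi e1, lintegral_lintegral_swap]
  swap
  · refine Measurable.aemeasurable ?_
    simp only [hf]; unfold Function.uncurry; fun_prop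
  have e2 : ∀ φ ∈ Ioo 0 Real.pi, ∫⁻ θ in Ioi (0 : ℝ), ENNReal.ofReal (f θ φ)
      = ENNReal.ofReal (Real.Gamma (1 + (1 - α) * n) / Real.pi * (Real.sin φ ^ n /
        (Real.sin ((1 - α) * φ) ^ ((1 - α) * n) * Real.sin (α * φ) ^ (α * n)))) := by
    intro φ hφ
    have hk := zolotarevKernel_pos h0 h1 hφ
    have s1 : 0 < Real.sin φ := Real.sin_pos_of_pos_of_lt_pi hφ.1 hφ.2
    have s2 : 0 < Real.sin (α * φ) :=
      Real.sin_pos_of_pos_of_lt_pi (mul_pos h0 hφ.1) (by nlinarith [hφ.2, hφ.1])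
    have s3 : 0 < Real.sin ((1 - α) * φ) :=
      Real.sin_pos_of_pos_of_lt_pi (mul_pos hβ hφ.1) (by nlinarith [hφ.2, hφ.1])
    have hq : -1 < (n : ℝ) + α / (1 - α) := by
      have : 0 ≤ (n : ℝ) + α / (1 - α) := by positivity
      linarith
    have hI := integral_rpow_mul_exp_neg_mul_rpow (p := 1 / (1 - α)) (by positivity) hq hk
    have hex : ((n : ℝ) + α / (1 - α) + 1) / (1 / (1 - α)) = 1 + (1 - α) * n := by
      field_simp; ring
    have hex' : -((n : ℝ) + α / (1 - α) + 1) / (1 / (1 - α)) = -1 + -((1 - α) * n) := by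
      rw [neg_div, hex]; ring
    rw [hex, hex'] at hI
    have hG : 0 < Real.Gamma (1 + (1 - α) * n) := Real.Gamma_pos_of_pos (by positivity)
    have hint := Integrable.of_integral_ne_zero (hI ▸ (by positivity :
      (zolotarevKernel α φ) ^ (-1 + -((1 - α) * (n : ℝ))) * (1 / (1 / (1 - α))) *
        Real.Gamma (1 + (1 - α) * n) ≠ 0))
    simp only [hf]
    rw [← ofReal_integral_eq_lintegral_ofReal (hint.mul_const _), integral_mul_const, hI]
    · congr 1
      have hpow : zolotarevKernel α φ ^ (-((1 - α) * (n : ℝ))) = Real.sin φ ^ n /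
          (Real.sin ((1 - α) * φ) ^ ((1 - α) * n) * Real.sin (α * φ) ^ (α * n)) := by
        unfold zolotarevKernel
        rw [Real.rpow_neg (by positivity), Real.div_rpow (by positivity) (by positivity),
          Real.mul_rpow (by positivity) (by positivity), ← Real.rpow_mul s2.le,
          ← Real.rpow_mul s1.le, inv_div]
        rw [show α / (1 - α) * ((1 - α) * n) = α * n by field_simp,
          show 1 / (1 - α) * ((1 - α) * n) = (n : ℝ) by field_simp, Real.rpow_natCast]
      rw [Real.rpow_add hk, hpow, Real.rpow_neg_one]
      field_simp
    · refine (ae_restrict_iff' measurableSet_Ioi).mpr (Eventually.of_forall fun θ hθ => ?_)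
      have hθ' : (0 : ℝ) < θ := hθ
      simp only [Pi.zero_apply]; positivity
  obtain ⟨hDi, hDv⟩ := integral_kernel_pow h0 h1 n
  rw [intervalIntegrable_iff_integrableOn_Ioo_of_le hpi.le] at hDi
  rw [intervalIntegral.integral_of_le hpi.le, integral_Ioc_eq_integral_Ioo] at hDv
  rw [setLIntegral_congr_fun measurableSet_Ioo e2,
    ← ofReal_integral_eq_lintegral_ofReal (hDi.const_mul _), integral_const_mul, hDv]
  · congr 1
    have hG : 0 < Real.Gamma (1 + (1 - α) * n) := Real.Gamma_pos_of_pos (by positivity)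
    field_simp
  · refine (ae_restrict_iff' measurableSet_Ioo).mpr (Eventually.of_forall fun φ hφ => ?_)
    have s1 : 0 < Real.sin φ := Real.sin_pos_of_pos_of_lt_pi hφ.1 hφ.2
    have s2 : 0 < Real.sin (α * φ) :=
      Real.sin_pos_of_pos_of_lt_pi (mul_pos h0 hφ.1) (by nlinarith [hφ.2, hφ.1])
    have s3 : 0 < Real.sin ((1 - α) * φ) :=
      Real.sin_pos_of_pos_of_lt_pi (mul_pos hβ hφ.1) (by nlinarith [hφ.2, hφ.1])
    have hG : 0 < Real.Gamma (1 + (1 - α) * n) := Real.Gamma_pos_of_pos (by positivity)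
    simp only [Pi.zero_apply]; positivity

theorem summable_pow_mul_inv_Gamma {α : ℝ} (h0 : 0 < α) (R : ℝ) (hR : 0 ≤ R) :
    Summable fun n : ℕ => R ^ n * (Real.Gamma (1 + α * n))⁻¹ := by
  set K : ℝ := (2 * (R + 1)) ^ (1 / α) with hK
  have hKpos : 0 < K := by positivity
  have hKα : K ^ α = 2 * (R + 1) := by
    rw [hK, ← Real.rpow_mul (by positivity), one_div, inv_mul_cancel₀ h0.ne', Real.rpow_one]
  have hlow : ∀ n : ℕ, Real.exp (-K) * (2 * (R + 1)) ^ n ≤ Real.Gamma (1 + α * n) := by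
    intro n
    have hs : (0 : ℝ) < 1 + α * n := by positivity
    have hconv := Real.GammaIntegral_convergent hs
    rw [Real.Gamma_eq_integral hs]
    calc Real.exp (-K) * (2 * (R + 1)) ^ n
        = ∫ x in Ioi K, Real.exp (-x) * K ^ (α * n) := by
          rw [integral_mul_const, integral_exp_neg_Ioi, Real.rpow_mul hKpos.le, hKα,
            Real.rpow_natCast]
      _ ≤ ∫ x in Ioi K, Real.exp (-x) * x ^ (1 + α * n - 1) := by
          refine setIntegral_mono_on ((integrableOn_exp_neg_Ioi K).mul_const _)
            (hconv.mono_set (Ioi_subset_Ioi hKpos.le)) measurableSet_Ioi fun x hx => ?_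
          have : K ≤ x := (mem_Ioi.mp hx).le
          rw [add_sub_cancel_left]
          gcongr
      _ ≤ _ := by
          refine setIntegral_mono_set hconv ?_ (Ioi_subset_Ioi hKpos.le).eventuallyLE
          refine (ae_restrict_iff' measurableSet_Ioi).mpr (Eventually.of_forall fun x hx => ?_)
          have : (0 : ℝ) < x := hx
          simp only [Pi.zero_apply]; positivity
  refine Summable.of_nonneg_of_le (fun n => ?_) (fun n => ?_)
    ((summable_geometric_two).mul_left (Real.exp K))
  · have : 0 < Real.Gamma (1 + α * n) := Real.Gamma_pos_of_pos (by positivity)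
    positivity
  · have hG : 0 < Real.Gamma (1 + α * n) := Real.Gamma_pos_of_pos (by positivity)
    rw [← div_eq_mul_inv, div_le_iff₀ hG]
    calc R ^ n ≤ (R + 1) ^ n := by gcongr; linarith
      _ = Real.exp K * (1 / 2) ^ n * (Real.exp (-K) * (2 * (R + 1)) ^ n) := by
          rw [mul_pow, Real.exp_neg, one_div, inv_pow]
          field_simp
      _ ≤ _ := by gcongr; exact hlow n

/-- `∫ h_α(θ) e^{zθ} dθ = E_{α,1}(z)` for every complex `z`; this identity determines the continuous
function `h_α` on `(0, ∞)`. -/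
theorem integral_wrightDensity_mul_exp {α : ℝ} (h0 : 0 < α) (h1 : α < 1) (z : ℂ) :
    ∫ θ in Ioi (0 : ℝ), (wrightDensity α θ : ℂ) * Complex.exp (z * θ) = mittagLeffler α 1 z := by
  have hm := measurable_wrightDensity α
  set g : ℕ → ℝ → ℝ := fun n θ => wrightDensity α θ * θ ^ n with hg
  have gnn : ∀ n, 0 ≤ᵐ[volume.restrict (Ioi 0)] g n := fun n =>
    (ae_restrict_iff' measurableSet_Ioi).mpr (Eventually.of_forall fun θ hθ => by
      have := wrightDensity_pos h0 h1 hθ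
      have : (0 : ℝ) < θ := hθ
      simp only [hg, Pi.zero_apply]; positivity)
  have gmeas : ∀ n, AEStronglyMeasurable (g n) (volume.restrict (Ioi 0)) := fun n =>
    Measurable.aestronglyMeasurable (by simp only [hg]; fun_prop)
  have Gpos : ∀ n : ℕ, 0 < Real.Gamma (1 + α * n) := fun n => Real.Gamma_pos_of_pos (by positivity)
  have Gpos' : ∀ n : ℕ, 0 < Real.Gamma ((n : ℝ) + 1) := fun n =>
    Real.Gamma_pos_of_pos (by positivity)
  have gint : ∀ n, IntegrableOn (g n) (Ioi 0) := fun n => by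
    refine ⟨gmeas n, ?_⟩
    rw [hasFiniteIntegral_iff_ofReal (gnn n), lintegral_wrightDensity_pow h0 h1 n]
    exact ENNReal.ofReal_lt_top
  have gval : ∀ n : ℕ, ∫ θ in Ioi (0 : ℝ), g n θ
      = Real.Gamma (n + 1) * (Real.Gamma (1 + α * n))⁻¹ := fun n => by
    rw [integral_eq_lintegral_of_nonneg_ae (gnn n) (gmeas n), lintegral_wrightDensity_pow h0 h1 n,
      ENNReal.toReal_ofReal]
    have := Gpos n; have := Gpos' n; positivity
  set F : ℕ → ℝ → ℂ := fun n θ => (z ^ n / (n.factorial : ℂ)) * (g n θ : ℂ) with hF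
  have Fint : ∀ n, Integrable (F n) (volume.restrict (Ioi 0)) := fun n =>
    (gint n).ofReal.const_mul _
  have Fval : ∀ n : ℕ, ∫ θ in Ioi (0 : ℝ), F n θ
      = z ^ n / Complex.Gamma ((α : ℂ) * n + (1 : ℝ)) := fun n => by
    simp only [hF]
    rw [integral_const_mul, integral_complex_ofReal, gval, Real.Gamma_nat_eq_factorial]
    have e : (α : ℂ) * n + (1 : ℝ) = ((1 + α * n : ℝ) : ℂ) := by push_cast; ring
    rw [e, Complex.Gamma_ofReal]
    have : ((n.factorial : ℕ) : ℂ) ≠ 0 := by exact_mod_cast n.factorial_ne_zero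
    push_cast
    field_simp
  have Fnorm : ∀ n : ℕ, ∫ θ in Ioi (0 : ℝ), ‖F n θ‖ = ‖z‖ ^ n * (Real.Gamma (1 + α * n))⁻¹ := by
    intro n
    have : ∀ᵐ θ ∂volume.restrict (Ioi (0 : ℝ)), ‖F n θ‖ = ‖z‖ ^ n / n.factorial * g n θ := by
      filter_upwards [gnn n] with θ hθ
      simp only [hF, norm_mul, norm_div, norm_pow, Complex.norm_natCast, Complex.norm_real]
      rw [Real.norm_of_nonneg hθ]
    rw [integral_congr_ae this, integral_const_mul, gval, Real.Gamma_nat_eq_factorial]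
    have : ((n.factorial : ℕ) : ℝ) ≠ 0 := by exact_mod_cast n.factorial_ne_zero
    field_simp
  have hsum : Summable fun n => ∫ θ in Ioi (0 : ℝ), ‖F n θ‖ := by
    simp only [Fnorm]; exact summable_pow_mul_inv_Gamma h0 _ (norm_nonneg z)
  have hpt : ∀ θ : ℝ, ∑' n, F n θ = (wrightDensity α θ : ℂ) * Complex.exp (z * θ) := by
    intro θ
    have h := (NormedSpace.expSeries_div_hasSum_exp (𝔸 := ℂ) (z * θ)).mul_left (wrightDensity α θ : ℂ)
    rw [← Complex.exp_eq_exp_ℂ] at h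
    rw [← h.tsum_eq]
    refine tsum_congr fun n => ?_
    simp only [hF, hg]
    push_cast
    ring
  have key := hasSum_integral_of_summable_integral_norm Fint hsum
  simp only [hpt] at key
  rw [← key.tsum_eq]
  unfold mittagLeffler
  exact tsum_congr Fval

/-- The integral in the previous identity converges absolutely. -/
theorem integrableOn_wrightDensity_mul_exp {α : ℝ} (h0 : 0 < α) (h1 : α < 1) (z : ℂ) :
    IntegrableOn (fun θ : ℝ => (wrightDensity α θ : ℂ) * Complex.exp (z * θ)) (Ioi 0) := by
  have hm := measurable_wrightDensity α
  have hs := summable_pow_mul_inv_Gamma h0 _ (norm_nonneg z)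
  have hML : mittagLeffler α 1 (‖z‖ : ℂ)
      = ((∑' n : ℕ, ‖z‖ ^ n * (Real.Gamma (1 + α * n))⁻¹ : ℝ) : ℂ) := by
    unfold mittagLeffler
    rw [Complex.ofReal_tsum]
    refine tsum_congr fun n => ?_
    have e : (α : ℂ) * n + (1 : ℝ) = ((1 + α * n : ℝ) : ℂ) := by push_cast; ring
    rw [e, Complex.Gamma_ofReal]
    push_cast
    rw [div_eq_mul_inv]
  have hpos : 0 < ∑' n : ℕ, ‖z‖ ^ n * (Real.Gamma (1 + α * n))⁻¹ := by
    refine hs.tsum_pos (fun n => ?_) 0 (by simp)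
    have : 0 < Real.Gamma (1 + α * n) := Real.Gamma_pos_of_pos (by positivity)
    positivity
  have hne : ∫ θ in Ioi (0 : ℝ), (wrightDensity α θ : ℂ) * Complex.exp (‖z‖ * θ) ≠ 0 := by
    rw [integral_wrightDensity_mul_exp h0 h1, hML]
    exact_mod_cast hpos.ne'
  refine (Integrable.of_integral_ne_zero hne).mono
    (Measurable.aestronglyMeasurable (by fun_prop)) ?_
  refine (ae_restrict_iff' measurableSet_Ioi).mpr (Eventually.of_forall fun θ hθ => ?_)
  rw [norm_mul, norm_mul, Complex.norm_exp, Complex.norm_exp]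
  have hθ' : (0 : ℝ) < θ := hθ
  have : (z * θ).re ≤ ((‖z‖ : ℂ) * θ).re := by
    simp only [Complex.re_mul_ofReal, Complex.ofReal_re]
    gcongr
    exact Complex.re_le_norm z
  gcongr

/-- Euclidean space `ℝᴺ`. -/
abbrev Space (N : ℕ) : Type := EuclideanSpace ℝ (Fin N)

/-- The heat kernel `G(t, x) = (4πt)^{-N/2} exp(-|x|² / (4t))`. -/
noncomputable def heatKernel {N : ℕ} (t : ℝ) (x : Space N) : ℝ :=
  1 / (4 * Real.pi * t) ^ ((N : ℝ) / 2) * Real.exp (-‖x‖ ^ 2 / (4 * t))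

/-- `(e^{tΔ} μ)(x) = ∫ G(t, x - y) dμ(y)`, with values in `[0, ∞]`. -/
noncomputable def heatSemigroup {N : ℕ} (t : ℝ) (μ : Measure (Space N)) (x : Space N) : ℝ≥0∞ :=
  ∫⁻ y, ENNReal.ofReal (heatKernel t (x - y)) ∂μ

/-- `P_α(t) μ = ∫₀^∞ h_α(θ) e^{t^α θ Δ} μ dθ`. -/
noncomputable def opP {N : ℕ} (α t : ℝ) (μ : Measure (Space N)) (x : Space N) : ℝ≥0∞ :=
  ∫⁻ θ in Ioi (0 : ℝ), ENNReal.ofReal (wrightDensity α θ) * heatSemigroup (t ^ α * θ) μ x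

/-- `S_α(t) μ = ∫₀^∞ θ h_α(θ) e^{t^α θ Δ} μ dθ`. -/
noncomputable def opS {N : ℕ} (α t : ℝ) (μ : Measure (Space N)) (x : Space N) : ℝ≥0∞ :=
  ∫⁻ θ in Ioi (0 : ℝ), ENNReal.ofReal (θ * wrightDensity α θ) * heatSemigroup (t ^ α * θ) μ x

/-- `u` is a (nonnegative, mild) solution on `[0, T] × ℝᴺ` of `∂ₜ^α u - Δu = u^p`, `u(0) = μ`:
`∞ > u(t, x) = [P_α(t) μ](x) + α ∫₀ᵗ (t - s)^{α - 1} [S_α(t - s) u(s)^p](x) ds` for almost all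
`t ∈ (0, T]` and `x ∈ ℝᴺ`. A function `f ≥ 0` is identified with the measure `f dx`. Values of `u`
outside `(0, T] × ℝᴺ` are irrelevant. -/
def IsSolution {N : ℕ} (α p T : ℝ) (μ : Measure (Space N)) (u : ℝ → Space N → ℝ≥0∞) : Prop :=
  Measurable (fun z : ℝ × Space N => u z.1 z.2) ∧
  ∀ᵐ t : ℝ, t ∈ Ioc 0 T → ∀ᵐ x : Space N,
    u t x < ∞ ∧
    u t x = opP α t μ x +
      ENNReal.ofReal α * ∫⁻ s in Ioo 0 t, ENNReal.ofReal ((t - s) ^ (α - 1)) *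
        opS α (t - s) (volume.withDensity fun y => u s y ^ p) x

/-- A global-in-time solution: a solution on `[0, T] × ℝᴺ` for every finite `T > 0`. -/
def IsGlobalSolution {N : ℕ} (α p : ℝ) (μ : Measure (Space N)) (u : ℝ → Space N → ℝ≥0∞) : Prop :=
  ∀ T : ℝ, 0 < T → IsSolution α p T μ u

/-- `B⁺(r)`: nonnegative finite (Borel, hence Radon) measures on `ℝᴺ` of total mass at most `r`. -/
def posBall (N : ℕ) (r : ℝ) : Set (Measure (Space N)) :=
  {μ | IsFiniteMeasure μ ∧ μ univ ≤ ENNReal.ofReal r}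

/-- `G_α`: nonnegative finite measures on `ℝᴺ` for which the problem with exponent `p` possesses a
global-in-time solution. -/
def globalData (N : ℕ) (α p : ℝ) : Set (Measure (Space N)) :=
  {ν | IsFiniteMeasure ν ∧ ∃ u : ℝ → Space N → ℝ≥0∞, IsGlobalSolution α p ν u}

/-- The Fujita exponent `p_F = 1 + 2/N`. -/
noncomputable def fujitaExponent (N : ℕ) : ℝ := 1 + 2 / (N : ℝ)

end TimeFracHeat

/-! At the Fujita exponent `(N / 2) * (p - 1) = 1`, so the assertion is that the critical mass `M`
satisfies `M ^ (p - 1) ~ 1 - α`. The factor `1 - α` has a single source, the integral of `s ^ (-α)`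
over `(0, t)`, which equals `t ^ (1 - α) / (1 - α)`. Indeed a profile of mass `M` spread over `|x| ≤
s ^ (α / 2)` has height about `M s ^ (-αN / 2)`, so the spatial integral of its `p`-th power is
about `M ^ p s ^ (-α)`, and the Duhamel term acts like a source of total mass about `M ^ p / (1 -
α)`. This is harmless if it is at most a multiple of `M` and self-amplifying if it exceeds one. At
`α = 1` the integral diverges logarithmically at both ends, in accordance with the absence of global
solutions for the critical heat equation.

Existence. The scale-invariant norm `sup_t t ^ (α / p) ‖u(t)‖_p` closes the Picard iteration:
Minkowski's inequality bounds the linear part by `C m t ^ (-α / p)`, and the Duhamel part costs a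
Beta-type integral of size `1 / (1 - α)`. If `m ^ (p - 1)` is a small multiple of `1 - α`, every
iterate stays in one ball; the iterates increase, and their supremum solves the equation
(`lintegral_mildMap_rpow_le`, `exists_isGlobalSolution`).

Necessity. Mass above `m` in some ball forces `u ≥ A t ^ (-αN / 2)` on `|x| ≤ t ^ (α / 2)` for late
times, with `A` proportional to `m`. Feeding this bound into the Duhamel term replaces `A` by a
multiple of `A ^ p / (1 - α)` at still later times (`parabolicLowerBound_step`). Once `A ^ (p - 1)`
exceeds a multiple of `1 - α` each step at least doubles `A`, and a sufficiently large `A` makes the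
solution infinite in finite time (`not_parabolicLowerBound`).

All constants are uniform as `α → 1`: moments of `h_α` of order `-γ`, `0 ≤ γ < 1`, stay bounded
(`exists_wrightDensity_moment_bound`), which serves existence, and `h_α` concentrates at `1`
(`eventually_half_le_lintegral_wrightDensity`), which bounds the subordinated kernels from below. -/

namespace TimeFracHeat

/-! ### Minkowski's integral inequality. -/

/-- Minkowski's integral inequality, for a family whose `L^p` norms are bounded by `b`. -/
theorem lintegral_rpow_lintegral_le {Θ X : Type*} [MeasurableSpace Θ] [MeasurableSpace X]
    {ν : Measure Θ} [SFinite ν] {μ : Measure X} [SFinite μ] {p : ℝ} (hp : 1 < p)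
    {F : Θ → X → ℝ≥0∞} (hF : Measurable (Function.uncurry F)) {b : Θ → ℝ≥0∞} (hb : Measurable b)
    (hb0 : ∀ᵐ θ ∂ν, b θ ≠ 0) (hbt : ∀ᵐ θ ∂ν, b θ ≠ ∞)
    (hFb : ∀ᵐ θ ∂ν, ∫⁻ x, F θ x ^ p ∂μ ≤ b θ ^ p) :
    ∫⁻ x, (∫⁻ θ, F θ x ∂ν) ^ p ∂μ ≤ (∫⁻ θ, b θ ∂ν) ^ p := by
  have hp0 : 0 < p := by linarith
  have hq := Real.HolderConjugate.conjExponent hp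
  set q := p.conjExponent with hqdef
  have hq0 : 0 < q := hq.symm.pos
  have hqp : 1 / q * p = p - 1 := by
    have := hq.one_sub_inv
    rw [one_div, ← this]; field_simp
  have hFx : ∀ x, Measurable fun θ => F θ x := fun x => hF.comp measurable_prodMk_right
  -- Hölder applied to `F = b ^ (1 / q) * (b ^ (-1 / q) * F)`. With this weight the bound on `F θ`
  -- turns `b ^ (1 - p) * b ^ p` into `b` after Tonelli, so no duality argument is required.
  have key : ∀ x, (∫⁻ θ, F θ x ∂ν) ^ p
      ≤ (∫⁻ θ, b θ ∂ν) ^ (p - 1) * ∫⁻ θ, b θ ^ (1 - p) * F θ x ^ p ∂ν := by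
    intro x
    have e : ∫⁻ θ, F θ x ∂ν = ∫⁻ θ, (fun θ => b θ ^ (1 / q)) θ *
        (fun θ => b θ ^ (-(1 / q)) * F θ x) θ ∂ν := by
      refine lintegral_congr_ae ?_
      filter_upwards [hb0, hbt] with θ h0 ht
      rw [← mul_assoc, ← ENNReal.rpow_add _ _ h0 ht]
      simp
    have h := ENNReal.lintegral_mul_le_Lp_mul_Lq ν hq.symm
      (f := fun θ => b θ ^ (1 / q)) (g := fun θ => b θ ^ (-(1 / q)) * F θ x)
      (hb.pow_const _).aemeasurable ((hb.pow_const _).mul (hFx x)).aemeasurable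
    calc (∫⁻ θ, F θ x ∂ν) ^ p
        ≤ ((∫⁻ θ, (b θ ^ (1 / q)) ^ q ∂ν) ^ (1 / q) *
          (∫⁻ θ, (b θ ^ (-(1 / q)) * F θ x) ^ p ∂ν) ^ (1 / p)) ^ p := by
          rw [e]; exact ENNReal.rpow_le_rpow h hp0.le
      _ = _ := by
          rw [ENNReal.mul_rpow_of_nonneg _ _ hp0.le, ← ENNReal.rpow_mul, ← ENNReal.rpow_mul, hqp,
            one_div_mul_cancel hp0.ne', ENNReal.rpow_one]
          congr 2
          · congr 1; ext θ
            rw [← ENNReal.rpow_mul, one_div_mul_cancel hq0.ne', ENNReal.rpow_one]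
          · ext θ
            rw [ENNReal.mul_rpow_of_nonneg _ _ hp0.le, ← ENNReal.rpow_mul, neg_mul, hqp, neg_sub]
  have hm2 : Measurable (Function.uncurry fun x θ => b θ ^ (1 - p) * F θ x ^ p) := by
    have := hF.comp measurable_swap
    exact ((hb.comp measurable_snd).pow_const _).mul (this.pow_const _)
  calc ∫⁻ x, (∫⁻ θ, F θ x ∂ν) ^ p ∂μ
      ≤ ∫⁻ x, (∫⁻ θ, b θ ∂ν) ^ (p - 1) * ∫⁻ θ, b θ ^ (1 - p) * F θ x ^ p ∂ν ∂μ :=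
        lintegral_mono key
    _ = (∫⁻ θ, b θ ∂ν) ^ (p - 1) * ∫⁻ θ, ∫⁻ x, b θ ^ (1 - p) * F θ x ^ p ∂μ ∂ν := by
        rw [← lintegral_lintegral_swap hm2.aemeasurable]
        exact lintegral_const_mul _ hm2.lintegral_prod_right'
    _ ≤ (∫⁻ θ, b θ ∂ν) ^ (p - 1) * ∫⁻ θ, b θ ∂ν := by
        refine mul_le_mul_right (lintegral_mono_ae ?_) _
        filter_upwards [hb0, hbt, hFb] with θ h0 ht h
        have hm : Measurable fun x => F θ x ^ p := (hF.comp measurable_prodMk_left).pow_const _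
        rw [lintegral_const_mul _ hm]
        calc b θ ^ (1 - p) * ∫⁻ x, F θ x ^ p ∂μ ≤ b θ ^ (1 - p) * b θ ^ p := by gcongr
          _ = b θ := by rw [← ENNReal.rpow_add _ _ h0 ht]; simp
    _ = _ := by
        nth_rewrite 2 [← ENNReal.rpow_one (∫⁻ θ, b θ ∂ν)]
        rw [← ENNReal.rpow_add_of_nonneg _ _ (by linarith) (by norm_num)]
        simp

/-- Minkowski's integral inequality with a weight. -/
theorem lintegral_rpow_lintegral_mul_le {Θ X : Type*} [MeasurableSpace Θ] [MeasurableSpace X]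
    {ν : Measure Θ} [SFinite ν] {μ : Measure X} [SFinite μ] {p : ℝ} (hp : 1 < p)
    {w : Θ → ℝ≥0∞} (hw : Measurable w)
    {F : Θ → X → ℝ≥0∞} (hF : Measurable (Function.uncurry F)) {b : Θ → ℝ≥0∞} (hb : Measurable b)
    (hb0 : ∀ᵐ θ ∂ν, b θ ≠ 0) (hbt : ∀ᵐ θ ∂ν, b θ ≠ ∞)
    (hFb : ∀ᵐ θ ∂ν, ∫⁻ x, F θ x ^ p ∂μ ≤ b θ ^ p) :
    ∫⁻ x, (∫⁻ θ, w θ * F θ x ∂ν) ^ p ∂μ ≤ (∫⁻ θ, w θ * b θ ∂ν) ^ p := by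
  -- The weight is absorbed into the measure, so it may vanish or be infinite while `b` alone must
  -- be positive and finite.
  have hac := withDensity_absolutelyContinuous ν w
  have h := lintegral_rpow_lintegral_le (ν := ν.withDensity w) (μ := μ) hp hF hb
    (hac.ae_le hb0) (hac.ae_le hbt) (hac.ae_le hFb)
  rw [lintegral_withDensity_eq_lintegral_mul _ hw hb] at h
  refine le_trans (le_of_eq (lintegral_congr fun x => ?_)) h
  have hFx : Measurable fun θ => F θ x := hF.comp measurable_prodMk_right
  rw [lintegral_withDensity_eq_lintegral_mul _ hw hFx]
  rfl

/-! ### Heat kernel and its subordinated versions. -/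

section Heat

variable {N : ℕ}

theorem measurable_heatKernel : Measurable fun z : ℝ × Space N => heatKernel z.1 z.2 := by
  unfold heatKernel; fun_prop

theorem heatKernel_pos {t : ℝ} (ht : 0 < t) (x : Space N) : 0 < heatKernel t x := by
  unfold heatKernel; positivity

theorem lintegral_heatKernel {t : ℝ} (ht : 0 < t) :
    ∫⁻ x : Space N, ENNReal.ofReal (heatKernel t x) = 1 := by
  have hb : 0 < 1 / (4 * t) := by positivity
  have hpi := Real.pi_pos
  have h := GaussianFourier.integral_rexp_neg_mul_sq_norm (V := Space N) hb
  have e : ∀ x : Space N, heatKernel t x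
      = 1 / (4 * Real.pi * t) ^ ((N : ℝ) / 2) * Real.exp (-(1 / (4 * t)) * ‖x‖ ^ 2) := by
    intro x; unfold heatKernel; congr 2; ring
  have hv : Real.pi / (1 / (4 * t)) = 4 * Real.pi * t := by field_simp
  rw [hv, finrank_euclideanSpace_fin] at h
  have hi := Integrable.of_integral_ne_zero (h ▸ (by positivity :
    (4 * Real.pi * t) ^ ((N : ℝ) / 2) ≠ 0))
  simp only [e]
  rw [← ofReal_integral_eq_lintegral_ofReal (hi.const_mul _)
    (Eventually.of_forall fun x => by simp only [Pi.zero_apply]; positivity), integral_const_mul, h]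
  have : (4 * Real.pi * t) ^ ((N : ℝ) / 2) ≠ 0 := by positivity
  rw [one_div_mul_cancel this, ENNReal.ofReal_one]

/-- For the Fujita exponent, `‖G(t, · - y)‖_p ≤ t^{-1/p}`. -/
theorem lintegral_heatKernel_rpow_le {p : ℝ} (hp : 1 < p) (hNp : (N : ℝ) / 2 * (p - 1) = 1)
    {t : ℝ} (ht : 0 < t) (y : Space N) :
    ∫⁻ x : Space N, ENNReal.ofReal (heatKernel t (x - y)) ^ p
      ≤ ENNReal.ofReal (t ^ (-(1 / p))) ^ p := by
  have hp0 : 0 < p := by linarith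
  have hpi := Real.pi_gt_three
  -- Interpolation between the sup norm and the unit mass: by criticality `(4πt) ^ (-N / 2)` raised
  -- to the power `p - 1` is exactly `(4πt)⁻¹`.
  have hle : ∀ x : Space N, ENNReal.ofReal (heatKernel t x) ^ p
      ≤ ENNReal.ofReal (t⁻¹) * ENNReal.ofReal (heatKernel t x) := by
    intro x
    have h0 := heatKernel_pos ht x
    rw [ENNReal.ofReal_rpow_of_nonneg h0.le hp0.le, ← ENNReal.ofReal_mul (by positivity)]
    refine ENNReal.ofReal_le_ofReal ?_
    have e1 : heatKernel t x ^ p = heatKernel t x ^ (p - 1) * heatKernel t x := by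
      rw [← Real.rpow_add_one h0.ne']; simp
    rw [e1]
    gcongr
    have h1 : heatKernel t x ≤ ((4 * Real.pi * t) ^ ((N : ℝ) / 2))⁻¹ := by
      unfold heatKernel
      rw [one_div]
      refine mul_le_of_le_one_right (by positivity) ?_
      rw [Real.exp_le_one_iff]
      exact div_nonpos_of_nonpos_of_nonneg (by simp) (by positivity)
    calc heatKernel t x ^ (p - 1) ≤ (((4 * Real.pi * t) ^ ((N : ℝ) / 2))⁻¹) ^ (p - 1) := by
          gcongr
      _ = (4 * Real.pi * t)⁻¹ := by
          rw [Real.inv_rpow (by positivity), ← Real.rpow_mul (by positivity), hNp, Real.rpow_one]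
      _ ≤ t⁻¹ := by
          refine inv_anti₀ ht ?_
          nlinarith
  have hm : Measurable fun x : Space N => ENNReal.ofReal (heatKernel t x) :=
    (measurable_heatKernel.comp measurable_prodMk_left).ennreal_ofReal
  rw [lintegral_sub_right_eq_self (fun x : Space N => ENNReal.ofReal (heatKernel t x) ^ p) y]
  calc ∫⁻ x : Space N, ENNReal.ofReal (heatKernel t x) ^ p
      ≤ ∫⁻ x : Space N, ENNReal.ofReal (t⁻¹) * ENNReal.ofReal (heatKernel t x) :=
        lintegral_mono hle
    _ = ENNReal.ofReal (t⁻¹) := by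
        rw [lintegral_const_mul _ hm, lintegral_heatKernel ht, mul_one]
    _ = _ := by
        rw [ENNReal.ofReal_rpow_of_nonneg (by positivity) hp0.le, ← Real.rpow_mul ht.le]
        rw [neg_mul, one_div_mul_cancel hp0.ne', Real.rpow_neg_one]

/-- The heat kernel subordinated with the weight `w`. -/
noncomputable def subordKernel (w : ℝ → ℝ≥0∞) (σ : ℝ) (z : Space N) : ℝ≥0∞ :=
  ∫⁻ θ in Ioi (0 : ℝ), w θ * ENNReal.ofReal (heatKernel (σ * θ) z)

theorem measurable_subordKernel {w : ℝ → ℝ≥0∞} (hw : Measurable w) :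
    Measurable fun z : ℝ × Space N => subordKernel w z.1 z.2 := by
  unfold subordKernel
  refine Measurable.lintegral_prod_right' (f := fun a : (ℝ × Space N) × ℝ =>
    w a.2 * ENNReal.ofReal (heatKernel (a.1.1 * a.2) a.1.2)) ?_
  have : Measurable fun a : (ℝ × Space N) × ℝ => heatKernel (a.1.1 * a.2) a.1.2 :=
    measurable_heatKernel.comp (f := fun a : (ℝ × Space N) × ℝ => (a.1.1 * a.2, a.1.2))
      (by fun_prop)
  fun_prop

/-- Tonelli turns the superposition of heat flows into one convolution. The weights `h_α(θ)` and `θ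
h_α(θ)` give both solution operators, so all later estimates are made on `subordKernel`. -/
theorem lintegral_mul_heatSemigroup_eq {w : ℝ → ℝ≥0∞} (hw : Measurable w) (σ : ℝ)
    (μ : Measure (Space N)) [SFinite μ] (x : Space N) :
    ∫⁻ θ in Ioi (0 : ℝ), w θ * heatSemigroup (σ * θ) μ x = ∫⁻ y, subordKernel w σ (x - y) ∂μ := by
  have hm : Measurable fun a : ℝ × Space N => ENNReal.ofReal (heatKernel (σ * a.1) (x - a.2)) :=
    (measurable_heatKernel.comp (f := fun a : ℝ × Space N => (σ * a.1, x - a.2))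
      (by fun_prop)).ennreal_ofReal
  unfold subordKernel heatSemigroup
  rw [← lintegral_lintegral_swap (f := fun θ y => w θ * ENNReal.ofReal (heatKernel (σ * θ) (x - y)))]
  · refine lintegral_congr fun θ => ?_
    exact (lintegral_const_mul _ (hm.comp measurable_prodMk_left)).symm
  · exact ((hw.comp measurable_fst).mul hm).aemeasurable

theorem opP_eq (α t : ℝ) (μ : Measure (Space N)) [SFinite μ] (x : Space N) :
    opP α t μ x
      = ∫⁻ y, subordKernel (fun θ => ENNReal.ofReal (wrightDensity α θ)) (t ^ α) (x - y) ∂μ :=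
  lintegral_mul_heatSemigroup_eq (measurable_wrightDensity α).ennreal_ofReal _ μ x

theorem opS_eq (α t : ℝ) (μ : Measure (Space N)) [SFinite μ] (x : Space N) :
    opS α t μ x
      = ∫⁻ y, subordKernel (fun θ => ENNReal.ofReal (θ * wrightDensity α θ)) (t ^ α) (x - y) ∂μ :=
  lintegral_mul_heatSemigroup_eq
    (measurable_id.mul (measurable_wrightDensity α)).ennreal_ofReal _ μ x

/-- Minkowski in `θ`, with the norm `(σθ) ^ (-1 / p)` of each heat kernel. This reduces the kernel
estimates to moments of order `-1 / p`. -/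
theorem lintegral_subordKernel_rpow_le {p : ℝ} (hp : 1 < p) (hNp : (N : ℝ) / 2 * (p - 1) = 1)
    {w : ℝ → ℝ≥0∞} (hw : Measurable w) {σ : ℝ} (hσ : 0 < σ) (y : Space N) :
    ∫⁻ x : Space N, subordKernel w σ (x - y) ^ p ≤ (ENNReal.ofReal (σ ^ (-(1 / p))) *
      ∫⁻ θ in Ioi (0 : ℝ), w θ * ENNReal.ofReal (θ ^ (-(1 / p)))) ^ p := by
  unfold subordKernel
  have hm : Measurable fun a : ℝ × Space N => ENNReal.ofReal (heatKernel (σ * a.1) (a.2 - y)) :=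
    (measurable_heatKernel.comp (f := fun a : ℝ × Space N => (σ * a.1, a.2 - y))
      (by fun_prop)).ennreal_ofReal
  refine (lintegral_rpow_lintegral_mul_le hp hw
    (F := fun θ x => ENNReal.ofReal (heatKernel (σ * θ) (x - y))) hm
    (b := fun θ => ENNReal.ofReal ((σ * θ) ^ (-(1 / p)))) (by fun_prop) ?_ ?_ ?_).trans ?_
  · filter_upwards [ae_restrict_mem measurableSet_Ioi] with θ hθ
    have : (0 : ℝ) < θ := hθ
    rw [ne_eq, ENNReal.ofReal_eq_zero, not_le]
    positivity
  · exact Eventually.of_forall fun θ => ENNReal.ofReal_ne_top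
  · filter_upwards [ae_restrict_mem measurableSet_Ioi] with θ hθ
    exact lintegral_heatKernel_rpow_le hp hNp (mul_pos hσ hθ) y
  · rw [← lintegral_const_mul _ (by fun_prop)]
    refine ENNReal.rpow_le_rpow (le_of_eq ?_) (by linarith)
    refine setLIntegral_congr_fun measurableSet_Ioi fun θ hθ => ?_
    have : (0 : ℝ) < θ := hθ
    rw [Real.mul_rpow hσ.le this.le, ENNReal.ofReal_mul (by positivity)]
    ring

end Heat

/-! ### Moments and concentration of the Wright density as `α → 1`. -/

/-- Jordan's inequality `sin ψ ≥ 2ψ / π` near `0` and its reflection near `π` reduce this to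
integrable powers. -/
theorem lintegral_sin_rpow_neg_lt_top {γ : ℝ} (hγ0 : 0 ≤ γ) (hγ1 : γ < 1) :
    ∫⁻ φ in Ioo 0 Real.pi, ENNReal.ofReal (Real.sin φ ^ (-γ)) < ∞ := by
  have hpi := Real.pi_pos
  have hi1 : IntervalIntegrable (fun φ : ℝ => φ ^ (-γ)) volume 0 Real.pi :=
    intervalIntegral.intervalIntegrable_rpow' (by linarith)
  have hi2 : IntervalIntegrable (fun φ : ℝ => (Real.pi - φ) ^ (-γ)) volume 0 Real.pi := by
    have := (hi1.comp_sub_left Real.pi).symm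
    simpa using this
  have hi := (hi1.add hi2).const_mul ((2 / Real.pi) ^ (-γ))
  rw [intervalIntegrable_iff_integrableOn_Ioo_of_le hpi.le] at hi
  refine lt_of_le_of_lt (setLIntegral_mono' measurableSet_Ioo fun φ hφ => ?_)
    hi.lintegral_lt_top
  refine ENNReal.ofReal_le_ofReal ?_
  have hφ0 : 0 < φ := hφ.1
  have hφ1 : 0 < Real.pi - φ := by linarith [hφ.2]
  have key : ∀ ψ : ℝ, 0 < ψ → ψ ≤ Real.pi / 2 → Real.sin ψ ^ (-γ) ≤
      (2 / Real.pi) ^ (-γ) * ψ ^ (-γ) := by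
    intro ψ h0 h1
    rw [← Real.mul_rpow (by positivity) h0.le]
    exact Real.rpow_le_rpow_of_nonpos (by positivity) (Real.mul_le_sin h0.le h1) (by linarith)
  have p1 : 0 ≤ φ ^ (-γ) := by positivity
  have p2 : 0 ≤ (Real.pi - φ) ^ (-γ) := by positivity
  have p3 : 0 ≤ (2 / Real.pi) ^ (-γ) := by positivity
  rcases le_total φ (Real.pi / 2) with h | h
  · refine (key φ hφ0 h).trans ?_
    gcongr; linarith
  · rw [← Real.sin_pi_sub]
    refine (key _ hφ1 (by linarith)).trans ?_
    gcongr; linarith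

/-- The numerator of the kernel is at most `1`, and the exponent `(1 - α) * γ` cancels the singular
power `1 / (1 - α)` of `sin φ`. The resulting bound is free of `α`. -/
theorem zolotarevKernel_rpow_le {α γ φ : ℝ} (h0 : 0 < α) (h1 : α < 1) (hγ0 : 0 ≤ γ)
    (hφ : φ ∈ Ioo 0 Real.pi) :
    zolotarevKernel α φ ^ ((1 - α) * γ) ≤ Real.sin φ ^ (-γ) := by
  have hβ : 0 < 1 - α := by linarith
  have s1 : 0 < Real.sin φ := Real.sin_pos_of_pos_of_lt_pi hφ.1 hφ.2
  have s2 : 0 < Real.sin (α * φ) :=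
    Real.sin_pos_of_pos_of_lt_pi (mul_pos h0 hφ.1) (by nlinarith [hφ.2, hφ.1])
  have s3 : 0 < Real.sin ((1 - α) * φ) :=
    Real.sin_pos_of_pos_of_lt_pi (mul_pos hβ hφ.1) (by nlinarith [hφ.2, hφ.1])
  have hk := zolotarevKernel_pos h0 h1 hφ
  have hle : zolotarevKernel α φ ≤ Real.sin φ ^ (-(1 / (1 - α))) := by
    unfold zolotarevKernel
    rw [Real.rpow_neg s1.le, ← one_div]
    gcongr
    exact mul_le_one₀ (Real.sin_le_one _) (by positivity)
      (Real.rpow_le_one s2.le (Real.sin_le_one _) (by positivity))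
  calc zolotarevKernel α φ ^ ((1 - α) * γ)
      ≤ (Real.sin φ ^ (-(1 / (1 - α)))) ^ ((1 - α) * γ) := by gcongr
    _ = _ := by
      rw [← Real.rpow_mul s1.le]; congr 1; field_simp

/-- Negative moments of the Wright density of order above `-1`. -/
theorem lintegral_wrightDensity_rpow_neg_le {α γ : ℝ} (h0 : 0 < α) (h1 : α < 1) (hγ0 : 0 ≤ γ)
    (hγ1 : γ < 1) :
    ∫⁻ θ in Ioi (0 : ℝ), ENNReal.ofReal (wrightDensity α θ * θ ^ (-γ))
      ≤ ENNReal.ofReal (Real.Gamma (1 - (1 - α) * γ)) *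
        ∫⁻ φ in Ioo 0 Real.pi, ENNReal.ofReal (Real.sin φ ^ (-γ)) := by
  have hβ : 0 < 1 - α := by linarith
  have hpi := Real.pi_pos
  have hpi3 := Real.pi_gt_three
  have hm := measurable_zolotarevKernel α
  set f : ℝ → ℝ → ℝ := fun θ φ => θ ^ (-γ + α / (1 - α)) *
    Real.exp (-zolotarevKernel α φ * θ ^ (1 / (1 - α))) *
      (zolotarevKernel α φ / (Real.pi * (1 - α))) with hf
  have e1 : ∀ θ ∈ Ioi (0 : ℝ), ENNReal.ofReal (wrightDensity α θ * θ ^ (-γ))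
      = ∫⁻ φ in Ioo 0 Real.pi, ENNReal.ofReal (f θ φ) := by
    intro θ hθ
    have hθ' : 0 < θ := hθ
    have hi := integrable_zolotarevKernel h0 h1 (c := θ ^ (1 / (1 - α))) (by positivity)
    have : ∀ φ, f θ φ = (θ ^ (-γ) * (θ ^ (α / (1 - α)) / (Real.pi * (1 - α)))) *
        (zolotarevKernel α φ * Real.exp (-zolotarevKernel α φ * θ ^ (1 / (1 - α)))) := by
      intro φ
      simp only [hf]
      rw [Real.rpow_add hθ']; ring
    simp only [this]
    rw [← ofReal_integral_eq_lintegral_ofReal (hi.const_mul _), integral_const_mul]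
    · congr 1; unfold wrightDensity; ring
    · refine (ae_restrict_iff' measurableSet_Ioo).mpr (Eventually.of_forall fun φ hφ => ?_)
      have := zolotarevKernel_pos h0 h1 hφ
      simp only [Pi.zero_apply]; positivity
  rw [setLIntegral_congr_fun measurableSet_Ioi e1, lintegral_lintegral_swap]
  swap
  · refine Measurable.aemeasurable ?_
    simp only [hf]; unfold Function.uncurry; fun_prop
  have hG : 0 < Real.Gamma (1 - (1 - α) * γ) := Real.Gamma_pos_of_pos (by nlinarith)
  rw [← lintegral_const_mul _ (by fun_prop)]
  refine setLIntegral_mono' measurableSet_Ioo fun φ hφ => ?_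
  have hk := zolotarevKernel_pos h0 h1 hφ
  have hq : -1 < -γ + α / (1 - α) := by
    have : 0 ≤ α / (1 - α) := by positivity
    linarith
  have hI := integral_rpow_mul_exp_neg_mul_rpow (p := 1 / (1 - α)) (by positivity) hq hk
  -- The radial integral is a Gamma function at this argument, which tends to `1` with `α`; hence
  -- the moment bound is uniform near `α = 1`.
  have hex : (-γ + α / (1 - α) + 1) / (1 / (1 - α)) = 1 - (1 - α) * γ := by
    field_simp; ring
  have hex' : -(-γ + α / (1 - α) + 1) / (1 / (1 - α)) = -1 + (1 - α) * γ := by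
    rw [neg_div, hex]; ring
  rw [hex, hex'] at hI
  have hint := Integrable.of_integral_ne_zero (hI ▸ (by positivity :
    (zolotarevKernel α φ) ^ (-1 + (1 - α) * γ) * (1 / (1 / (1 - α))) *
      Real.Gamma (1 - (1 - α) * γ) ≠ 0))
  simp only [hf]
  rw [← ofReal_integral_eq_lintegral_ofReal (hint.mul_const _), integral_mul_const, hI,
    ← ENNReal.ofReal_mul hG.le]
  · refine ENNReal.ofReal_le_ofReal ?_
    have hkz := zolotarevKernel_rpow_le h0 h1 hγ0 hφ
    rw [Real.rpow_add hk, Real.rpow_neg_one]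
    calc _ = Real.Gamma (1 - (1 - α) * γ) * zolotarevKernel α φ ^ ((1 - α) * γ) / Real.pi := by
          field_simp
      _ ≤ Real.Gamma (1 - (1 - α) * γ) * zolotarevKernel α φ ^ ((1 - α) * γ) :=
          div_le_self (by positivity) (by linarith)
      _ ≤ _ := by gcongr
  · refine (ae_restrict_iff' measurableSet_Ioi).mpr (Eventually.of_forall fun θ hθ => ?_)
    have hθ' : (0 : ℝ) < θ := hθ
    simp only [Pi.zero_apply]; positivity

theorem tendsto_Gamma_comp {g : ℝ → ℝ} (hg : Continuous g) (h1 : 0 < g 1) :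
    Tendsto (fun α => Real.Gamma (g α)) (𝓝[<] 1) (𝓝 (Real.Gamma (g 1))) := by
  have h : ContinuousAt Real.Gamma (g 1) := by
    refine (Real.differentiableAt_Gamma fun m hm => ?_).continuousAt
    have : (0 : ℝ) ≤ m := by positivity
    linarith
  exact (h.tendsto.comp (hg.tendsto 1)).mono_left nhdsWithin_le_nhds

theorem eventually_Ioo_half_one : ∀ᶠ α : ℝ in 𝓝[<] 1, α ∈ Ioo (1 / 2 : ℝ) 1 :=
  Ioo_mem_nhdsLT (by norm_num)

/-- The limits are the moments of the point mass at `1`; convergence for `n = 1, 2` is what gives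
concentration. -/
theorem tendsto_wrightDensity_moment (n : ℕ) :
    Tendsto (fun α : ℝ => Real.Gamma (n + 1) * (Real.Gamma (1 + α * n))⁻¹) (𝓝[<] 1) (𝓝 1) := by
  have h : Tendsto (fun α : ℝ => Real.Gamma (1 + α * n)) (𝓝[<] 1) (𝓝 (Real.Gamma (1 + 1 * n))) :=
    tendsto_Gamma_comp (g := fun α : ℝ => 1 + α * n) (by fun_prop) (by positivity)
  have hpos : 0 < Real.Gamma (1 + 1 * n) := Real.Gamma_pos_of_pos (by positivity)
  have := (h.inv₀ hpos.ne').const_mul (Real.Gamma (n + 1))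
  have e : Real.Gamma ((n : ℝ) + 1) * (Real.Gamma (1 + 1 * n))⁻¹ = 1 := by
    rw [one_mul, add_comm (1 : ℝ)] at *
    exact mul_inv_cancel₀ hpos.ne'
  rwa [e] at this

/-- The first integral is a genuine negative moment. For the second, `θ ^ (1 - γ) ≤ 1 + θ` reduces
to the moments of order `0` and `1`. -/
theorem exists_wrightDensity_moment_bound {γ : ℝ} (hγ0 : 0 ≤ γ) (hγ1 : γ < 1) :
    ∃ C : ℝ, 0 < C ∧ ∀ᶠ α : ℝ in 𝓝[<] 1,
      (∫⁻ θ in Ioi (0 : ℝ), ENNReal.ofReal (wrightDensity α θ) * ENNReal.ofReal (θ ^ (-γ)))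
        ≤ ENNReal.ofReal C ∧
      (∫⁻ θ in Ioi (0 : ℝ), ENNReal.ofReal (θ * wrightDensity α θ) * ENNReal.ofReal (θ ^ (-γ)))
        ≤ ENNReal.ofReal C := by
  have hfin := lintegral_sin_rpow_neg_lt_top hγ0 hγ1
  set I := ∫⁻ φ in Ioo 0 Real.pi, ENNReal.ofReal (Real.sin φ ^ (-γ)) with hI
  -- The first bound needs `2 * I` (the Gamma factor is eventually at most `2`), the second `1 + 2`
  -- (zeroth and first moments).
  refine ⟨2 * I.toReal + 3, by positivity, ?_⟩
  have t1 := tendsto_Gamma_comp (g := fun α : ℝ => 1 - (1 - α) * γ) (by fun_prop) (by norm_num)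
  simp only [sub_self, zero_mul, sub_zero, Real.Gamma_one] at t1
  filter_upwards [eventually_Ioo_half_one, t1.eventually_le_const (u := 2) (by norm_num),
    (tendsto_wrightDensity_moment 1).eventually_le_const (u := 2) (by norm_num)]
    with α hα hG hM
  have h0 : 0 < α := by linarith [hα.1]
  have m0 := lintegral_wrightDensity_pow h0 hα.2 0
  have m1 := lintegral_wrightDensity_pow h0 hα.2 1
  have hw := measurable_wrightDensity α
  constructor
  · have h := lintegral_wrightDensity_rpow_neg_le h0 hα.2 hγ0 hγ1
    calc _ = ∫⁻ θ in Ioi (0 : ℝ), ENNReal.ofReal (wrightDensity α θ * θ ^ (-γ)) := by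
          refine setLIntegral_congr_fun measurableSet_Ioi fun θ hθ => ?_
          rw [ENNReal.ofReal_mul (wrightDensity_pos h0 hα.2 hθ).le]
      _ ≤ ENNReal.ofReal 2 * I := h.trans (by gcongr)
      _ = ENNReal.ofReal (2 * I.toReal) := by
          rw [ENNReal.ofReal_mul (by norm_num), ENNReal.ofReal_toReal hfin.ne]
      _ ≤ _ := ENNReal.ofReal_le_ofReal (by linarith)
  · calc _ ≤ ∫⁻ θ in Ioi (0 : ℝ), (ENNReal.ofReal (wrightDensity α θ * θ ^ 0) +
            ENNReal.ofReal (wrightDensity α θ * θ ^ 1)) := by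
          refine setLIntegral_mono' measurableSet_Ioi fun θ hθ => ?_
          have hp := wrightDensity_pos h0 hα.2 hθ
          have hθ' : (0 : ℝ) < θ := hθ
          rw [← ENNReal.ofReal_mul (by positivity), ← ENNReal.ofReal_add (by positivity)
            (by positivity)]
          refine ENNReal.ofReal_le_ofReal ?_
          have : θ * θ ^ (-γ) ≤ 1 + θ := by
            rw [mul_comm, ← Real.rpow_add_one hθ'.ne']
            rcases le_total θ 1 with h | h
            · linarith [Real.rpow_le_one hθ'.le h (by linarith : 0 ≤ -γ + 1)]
            · have := Real.rpow_le_rpow_of_exponent_le h (by linarith : -γ + 1 ≤ 1)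
              rw [Real.rpow_one] at this; linarith
          calc θ * wrightDensity α θ * θ ^ (-γ) = wrightDensity α θ * (θ * θ ^ (-γ)) := by ring
            _ ≤ wrightDensity α θ * (1 + θ) := by gcongr
            _ = _ := by ring
      _ = ENNReal.ofReal (Real.Gamma ((0 : ℕ) + 1) * (Real.Gamma (1 + α * (0 : ℕ)))⁻¹) +
          ENNReal.ofReal (Real.Gamma ((1 : ℕ) + 1) * (Real.Gamma (1 + α * (1 : ℕ)))⁻¹) := by
          rw [lintegral_add_left (by fun_prop), m0, m1]
      _ ≤ ENNReal.ofReal 1 + ENNReal.ofReal 2 := by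
          gcongr
          simp
      _ ≤ _ := by
          rw [← ENNReal.ofReal_add (by norm_num) (by norm_num)]
          have : 0 ≤ I.toReal := ENNReal.toReal_nonneg
          exact ENNReal.ofReal_le_ofReal (by linarith)

/-- As `α → 1`, the Wright density concentrates near `1`. -/
theorem eventually_half_le_lintegral_wrightDensity :
    ∀ᶠ α : ℝ in 𝓝[<] 1, ENNReal.ofReal (1 / 2) ≤
      ∫⁻ θ in Icc (1 / 2 : ℝ) (3 / 2), ENNReal.ofReal (wrightDensity α θ) := by
  have t1 := tendsto_wrightDensity_moment 1
  have t2 := tendsto_wrightDensity_moment 2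
  filter_upwards [eventually_Ioo_half_one, t1.eventually_const_lt (u := 31 / 32) (by norm_num),
    t2.eventually_lt_const (u := 33 / 32) (by norm_num)] with α hα hm1 hm2
  have h0 : 0 < α := by linarith [hα.1]
  have m0 := lintegral_wrightDensity_pow h0 hα.2 0
  have m1 := lintegral_wrightDensity_pow h0 hα.2 1
  have m2 := lintegral_wrightDensity_pow h0 hα.2 2
  have hw := measurable_wrightDensity α
  set a1 := Real.Gamma ((1 : ℕ) + 1) * (Real.Gamma (1 + α * (1 : ℕ)))⁻¹
  set a2 := Real.Gamma ((2 : ℕ) + 1) * (Real.Gamma (1 + α * (2 : ℕ)))⁻¹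
  have e0 : Real.Gamma ((0 : ℕ) + 1) * (Real.Gamma (1 + α * (0 : ℕ)))⁻¹ = 1 := by simp
  rw [e0] at m0
  set I := ∫⁻ θ in Icc (1 / 2 : ℝ) (3 / 2), ENNReal.ofReal (wrightDensity α θ) with hI
  -- Chebyshev's inequality: `1 - 4 (θ - 1) ^ 2` is at most the indicator of `[1/2, 3/2]`, written
  -- without subtraction. The thresholds `31/32` and `33/32` then give `I ≥ 1 + 8 a1 - 4 a2 - 4 >
  -- 1/2`.
  have key : ENNReal.ofReal 1 + ENNReal.ofReal 8 * ENNReal.ofReal a1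
      ≤ I + (ENNReal.ofReal 4 * ENNReal.ofReal a2 + ENNReal.ofReal 4 * ENNReal.ofReal 1) := by
    have eI : I = ∫⁻ θ in Ioi (0 : ℝ),
        (Icc (1 / 2 : ℝ) (3 / 2)).indicator (fun θ => ENNReal.ofReal (wrightDensity α θ)) θ := by
      rw [setLIntegral_indicator measurableSet_Icc, inter_eq_left.mpr]
      intro θ hθ
      exact mem_Ioi.mpr (by linarith [hθ.1])
    have hind : Measurable ((Icc (1 / 2 : ℝ) (3 / 2)).indicator
        (fun θ => ENNReal.ofReal (wrightDensity α θ))) :=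
      hw.ennreal_ofReal.indicator measurableSet_Icc
    rw [eI]
    nth_rewrite 1 [← m0]
    rw [← m0, ← m1, ← m2, ← lintegral_const_mul _ (by fun_prop),
      ← lintegral_const_mul _ (by fun_prop), ← lintegral_const_mul _ (by fun_prop),
      ← lintegral_add_left (by fun_prop), ← lintegral_add_left (by fun_prop),
      ← lintegral_add_left hind]
    refine setLIntegral_mono' measurableSet_Ioi fun θ hθ => ?_
    have hp := wrightDensity_pos h0 hα.2 hθ
    have hθ' : (0 : ℝ) < θ := hθ
    rw [← ENNReal.ofReal_mul (by positivity), ← ENNReal.ofReal_mul (by positivity),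
      ← ENNReal.ofReal_mul (by positivity), ← ENNReal.ofReal_add (by positivity) (by positivity),
      ← ENNReal.ofReal_add (by positivity) (by positivity)]
    by_cases hmem : θ ∈ Icc (1 / 2 : ℝ) (3 / 2)
    · rw [indicator_of_mem hmem, ← ENNReal.ofReal_add (by positivity) (by positivity)]
      refine ENNReal.ofReal_le_ofReal ?_
      nlinarith [mul_nonneg hp.le (sq_nonneg (θ - 1))]
    · rw [indicator_of_notMem hmem, zero_add]
      refine ENNReal.ofReal_le_ofReal ?_
      have : 0 ≤ 4 * (θ - 1) ^ 2 - 1 := by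
        rw [mem_Icc, not_and_or, not_le, not_le] at hmem
        rcases hmem with h | h <;> nlinarith
      nlinarith [mul_nonneg hp.le this]
  by_contra! hlt
  have hfin : ENNReal.ofReal 4 * ENNReal.ofReal a2 + ENNReal.ofReal 4 * ENNReal.ofReal 1 ≠ ∞ :=
    ENNReal.add_ne_top.mpr ⟨ENNReal.mul_ne_top ENNReal.ofReal_ne_top ENNReal.ofReal_ne_top,
      ENNReal.mul_ne_top ENNReal.ofReal_ne_top ENNReal.ofReal_ne_top⟩
  have h := key.trans_lt (ENNReal.add_lt_add_right hfin hlt)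
  have ha1 : (0 : ℝ) ≤ a1 := by linarith
  have ha2 : (0 : ℝ) ≤ a2 := by
    have : 0 < Real.Gamma (1 + α * (2 : ℕ)) := Real.Gamma_pos_of_pos (by positivity)
    have : 0 < Real.Gamma ((2 : ℕ) + 1 : ℝ) := Real.Gamma_pos_of_pos (by positivity)
    positivity
  rw [← ENNReal.ofReal_mul (by positivity), ← ENNReal.ofReal_mul (by positivity),
    ← ENNReal.ofReal_mul (by positivity), ← ENNReal.ofReal_add (by positivity) (by positivity),
    ← ENNReal.ofReal_add (by positivity) (by positivity),
    ← ENNReal.ofReal_add (by positivity) (by positivity),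
    ENNReal.ofReal_lt_ofReal_iff (by positivity)] at h
  linarith

/-! ### Power integrals in time. -/

theorem setLIntegral_rpow_Ioo {r c : ℝ} (hr : -1 < r) (hc : 0 ≤ c) :
    ∫⁻ s in Ioo 0 c, ENNReal.ofReal (s ^ r) = ENNReal.ofReal (c ^ (r + 1) / (r + 1)) := by
  have hi : IntervalIntegrable (fun s : ℝ => s ^ r) volume 0 c :=
    intervalIntegral.intervalIntegrable_rpow' hr
  have hv := integral_rpow (a := 0) (b := c) (Or.inl hr)
  rw [intervalIntegral.integral_of_le hc, integral_Ioc_eq_integral_Ioo,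
    Real.zero_rpow (by linarith), sub_zero] at hv
  rw [intervalIntegrable_iff_integrableOn_Ioo_of_le hc] at hi
  rw [← hv, ofReal_integral_eq_lintegral_ofReal hi]
  refine (ae_restrict_iff' measurableSet_Ioo).mpr (Eventually.of_forall fun s hs => ?_)
  exact Real.rpow_nonneg hs.1.le _

theorem setLIntegral_sub_rpow_Ioo {r c t : ℝ} (hr : -1 < r) (hc : c ≤ t) :
    ∫⁻ s in Ioo c t, ENNReal.ofReal ((t - s) ^ r)
      = ENNReal.ofReal ((t - c) ^ (r + 1) / (r + 1)) := by
  rw [← setLIntegral_rpow_Ioo hr (sub_nonneg.mpr hc), ← lintegral_indicator measurableSet_Ioo,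
    ← lintegral_indicator measurableSet_Ioo,
    ← lintegral_sub_left_eq_self _ t]
  refine lintegral_congr fun s => ?_
  by_cases h : s ∈ Ioo 0 (t - c)
  · have h' : t - s ∈ Ioo c t := ⟨by linarith [h.2], by linarith [h.1]⟩
    rw [indicator_of_mem h, indicator_of_mem h', sub_sub_cancel]
  · rw [indicator_of_notMem h, indicator_of_notMem]
    exact fun h' => h ⟨by linarith [h'.2], by linarith [h'.1]⟩

/-- A bound for an incomplete Beta integral. -/
theorem setLIntegral_beta_le {a α t : ℝ} (ha : 0 < a) (ha1 : a < 1) (hα0 : 0 < α) (hα1 : α < 1)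
    (ht : 0 < t) :
    ∫⁻ s in Ioo 0 t, ENNReal.ofReal ((t - s) ^ (a - 1)) * ENNReal.ofReal (s ^ (-α))
      ≤ ENNReal.ofReal (2 * (1 + 1 / a) / (1 - α) * t ^ (a - α)) := by
  have hβ : 0 < 1 - α := by linarith
  -- On each half the nonsingular factor is frozen at `t / 2`. The half near `0` produces `1 / (1 -
  -- α)`, the half near `t` only `1 / a`.
  have hsub : Ioo 0 t ⊆ Ioo 0 (t / 2) ∪ (Ioo (t / 2) t ∪ {t / 2}) := by
    intro s hs
    rcases lt_trichotomy s (t / 2) with h | h | h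
    · exact Or.inl ⟨hs.1, h⟩
    · exact Or.inr (Or.inr h)
    · exact Or.inr (Or.inl ⟨h, hs.2⟩)
  have p1 : ∫⁻ s in Ioo 0 (t / 2), ENNReal.ofReal ((t - s) ^ (a - 1)) * ENNReal.ofReal (s ^ (-α))
      ≤ ENNReal.ofReal ((t / 2) ^ (a - 1) * ((t / 2) ^ (-α + 1) / (-α + 1))) := by
    rw [ENNReal.ofReal_mul (by positivity), ← setLIntegral_rpow_Ioo (by linarith) (by positivity),
      ← lintegral_const_mul _ (by fun_prop)]
    refine setLIntegral_mono' measurableSet_Ioo fun s hs => ?_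
    gcongr ENNReal.ofReal ?_ * _
    exact Real.rpow_le_rpow_of_nonpos (by positivity) (by linarith [hs.2]) (by linarith)
  have p2 : ∫⁻ s in Ioo (t / 2) t, ENNReal.ofReal ((t - s) ^ (a - 1)) * ENNReal.ofReal (s ^ (-α))
      ≤ ENNReal.ofReal ((t / 2) ^ (-α) * ((t - t / 2) ^ (a - 1 + 1) / (a - 1 + 1))) := by
    rw [ENNReal.ofReal_mul (by positivity),
      ← setLIntegral_sub_rpow_Ioo (by linarith) (by linarith),
      ← lintegral_const_mul _ (by fun_prop)]
    refine setLIntegral_mono' measurableSet_Ioo fun s hs => ?_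
    rw [mul_comm]
    gcongr ENNReal.ofReal ?_ * _
    exact Real.rpow_le_rpow_of_nonpos (by positivity) hs.1.le (by linarith)
  have hx : 0 < t / 2 := by positivity
  have q1 : (t / 2) ^ (a - 1) * ((t / 2) ^ (-α + 1) / (-α + 1))
      = (t / 2) ^ (a - α) * (1 / (1 - α)) := by
    rw [← mul_div_assoc, ← Real.rpow_add hx]
    ring_nf
  have q2 : (t / 2) ^ (-α) * ((t - t / 2) ^ (a - 1 + 1) / (a - 1 + 1))
      = (t / 2) ^ (a - α) * (1 / a) := by
    rw [show t - t / 2 = t / 2 by ring, ← mul_div_assoc, ← Real.rpow_add hx]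
    ring_nf
  calc _ ≤ ∫⁻ s in Ioo 0 (t / 2) ∪ (Ioo (t / 2) t ∪ {t / 2}),
        ENNReal.ofReal ((t - s) ^ (a - 1)) * ENNReal.ofReal (s ^ (-α)) := lintegral_mono_set hsub
    _ ≤ (∫⁻ s in Ioo 0 (t / 2), ENNReal.ofReal ((t - s) ^ (a - 1)) * ENNReal.ofReal (s ^ (-α))) +
        ((∫⁻ s in Ioo (t / 2) t, ENNReal.ofReal ((t - s) ^ (a - 1)) * ENNReal.ofReal (s ^ (-α))) +
        ∫⁻ s in {t / 2}, ENNReal.ofReal ((t - s) ^ (a - 1)) * ENNReal.ofReal (s ^ (-α))) :=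
        (lintegral_union_le _ _ _).trans (add_le_add_right (lintegral_union_le _ _ _) _)
    _ ≤ ENNReal.ofReal ((t / 2) ^ (a - α) * (1 / (1 - α)))
        + ENNReal.ofReal ((t / 2) ^ (a - α) * (1 / a)) := by
        rw [q1] at p1
        rw [q2] at p2
        have : ∫⁻ s in {t / 2}, ENNReal.ofReal ((t - s) ^ (a - 1)) * ENNReal.ofReal (s ^ (-α)) = 0 :=
          setLIntegral_measure_zero _ _ (by simp)
        rw [this, add_zero]
        exact add_le_add p1 p2
    _ ≤ _ := by
        rw [← ENNReal.ofReal_add (by positivity) (by positivity)]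
        refine ENNReal.ofReal_le_ofReal ?_
        -- The factor `2` suffices because `a - α > -1`.
        have h2 : (t / 2) ^ (a - α) ≤ 2 * t ^ (a - α) := by
          rw [Real.div_rpow ht.le (by norm_num), div_eq_mul_inv, ← Real.rpow_neg (by norm_num),
            mul_comm]
          gcongr
          calc (2 : ℝ) ^ (-(a - α)) ≤ 2 ^ (1 : ℝ) :=
                Real.rpow_le_rpow_of_exponent_le (by norm_num) (by linarith)
            _ = 2 := Real.rpow_one _
        have h3 : 1 / (1 - α) + 1 / a ≤ (1 + 1 / a) / (1 - α) := by
          rw [add_div]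
          refine add_le_add_right ?_ _
          rw [le_div_iff₀ hβ]
          have : 0 < 1 / a := by positivity
          nlinarith
        calc _ = (t / 2) ^ (a - α) * (1 / (1 - α) + 1 / a) := by ring
          _ ≤ (2 * t ^ (a - α)) * ((1 + 1 / a) / (1 - α)) := by gcongr
          _ = _ := by ring

/-! ### Global existence for small mass. -/

section Existence

variable {N : ℕ}

/-- The right-hand side of the integral equation. -/
noncomputable def mildMap (α p : ℝ) (μ : Measure (Space N)) (u : ℝ → Space N → ℝ≥0∞) (t : ℝ)
    (x : Space N) : ℝ≥0∞ :=
  opP α t μ x + ENNReal.ofReal α * ∫⁻ s in Ioo 0 t, ENNReal.ofReal ((t - s) ^ (α - 1)) *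
    opS α (t - s) (volume.withDensity fun y => u s y ^ p) x

/-- The kernel of the Duhamel term, up to the factor `α`. -/
noncomputable def duhamelKernel (α τ : ℝ) (z : Space N) : ℝ≥0∞ :=
  ENNReal.ofReal (τ ^ (α - 1)) *
    subordKernel (fun θ => ENNReal.ofReal (θ * wrightDensity α θ)) (τ ^ α) z

theorem measurable_duhamelKernel (α : ℝ) :
    Measurable fun z : ℝ × Space N => duhamelKernel α z.1 z.2 := by
  unfold duhamelKernel
  refine Measurable.mul (by fun_prop) ?_
  exact (measurable_subordKernel (measurable_id.mul (measurable_wrightDensity α)).ennreal_ofReal).comp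
    (f := fun z : ℝ × Space N => (z.1 ^ α, z.2)) (by fun_prop)

theorem opS_withDensity_eq (α τ : ℝ) {f : Space N → ℝ≥0∞} (hf : Measurable f) (x : Space N) :
    ENNReal.ofReal (τ ^ (α - 1)) * opS α τ (volume.withDensity f) x
      = ∫⁻ y, f y * duhamelKernel α τ (x - y) := by
  have hk : Measurable fun y : Space N =>
      subordKernel (fun θ => ENNReal.ofReal (θ * wrightDensity α θ)) (τ ^ α) (x - y) :=
    (measurable_subordKernel (measurable_id.mul (measurable_wrightDensity α)).ennreal_ofReal).comp
      (f := fun y : Space N => (τ ^ α, x - y)) (by fun_prop)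
  rw [opS_eq, lintegral_withDensity_eq_lintegral_mul _ hf hk, ← lintegral_const_mul _ (hf.mul hk)]
  refine lintegral_congr fun y => ?_
  simp only [Pi.mul_apply, duhamelKernel]
  ring

/-- A single integral over space-time is the form to which both monotone convergence and Minkowski
apply. -/
theorem mildMap_eq (α p : ℝ) (μ : Measure (Space N)) {u : ℝ → Space N → ℝ≥0∞}
    (hu : Measurable fun z : ℝ × Space N => u z.1 z.2) (t : ℝ) (x : Space N) :
    mildMap α p μ u t x = opP α t μ x + ENNReal.ofReal α *
      ∫⁻ z, u z.1 z.2 ^ p * duhamelKernel α (t - z.1) (x - z.2)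
        ∂((volume.restrict (Ioo 0 t)).prod volume) := by
  unfold mildMap
  congr 2
  rw [lintegral_prod]
  · refine lintegral_congr fun s => ?_
    exact opS_withDensity_eq α (t - s) ((hu.comp measurable_prodMk_left).pow_const p) x
  · refine ((hu.pow_const p).mul ?_).aemeasurable
    exact (measurable_duhamelKernel α).comp (f := fun z : ℝ × Space N => (t - z.1, x - z.2))
      (by fun_prop)

/-- The domain `(0, t)` moves with the parameter, so it is encoded as a condition in the integrand
before measurability of parameter integrals is used. -/
theorem measurable_mildMap (α p : ℝ) (μ : Measure (Space N)) [SFinite μ]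
    {u : ℝ → Space N → ℝ≥0∞} (hu : Measurable fun z : ℝ × Space N => u z.1 z.2) :
    Measurable fun z : ℝ × Space N => mildMap α p μ u z.1 z.2 := by
  have h1 : Measurable fun z : ℝ × Space N => opP α z.1 μ z.2 := by
    simp only [opP_eq]
    refine Measurable.lintegral_prod_right' (f := fun a : (ℝ × Space N) × Space N =>
      subordKernel (fun θ => ENNReal.ofReal (wrightDensity α θ)) (a.1.1 ^ α) (a.1.2 - a.2)) ?_
    exact (measurable_subordKernel (measurable_wrightDensity α).ennreal_ofReal).comp
      (f := fun a : (ℝ × Space N) × Space N => (a.1.1 ^ α, a.1.2 - a.2)) (by fun_prop)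
  refine h1.add (Measurable.const_mul ?_ _)
  have e : ∀ (z : ℝ × Space N), ∫⁻ s in Ioo 0 z.1, ENNReal.ofReal ((z.1 - s) ^ (α - 1)) *
      opS α (z.1 - s) (volume.withDensity fun y => u s y ^ p) z.2
      = ∫⁻ s, if 0 < s ∧ s < z.1 then
        ∫⁻ y, u s y ^ p * duhamelKernel α (z.1 - s) (z.2 - y) else 0 := by
    intro z
    rw [← lintegral_indicator measurableSet_Ioo]
    refine lintegral_congr fun s => ?_
    by_cases h : 0 < s ∧ s < z.1
    · rw [if_pos h, indicator_of_mem (show s ∈ Ioo 0 z.1 from h)]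
      exact opS_withDensity_eq α (z.1 - s) ((hu.comp measurable_prodMk_left).pow_const p) z.2
    · rw [if_neg h, indicator_of_notMem (show s ∉ Ioo 0 z.1 from h)]
  simp only [e]
  refine Measurable.lintegral_prod_right' (f := fun a : (ℝ × Space N) × ℝ =>
    if 0 < a.2 ∧ a.2 < a.1.1 then
        ∫⁻ y, u a.2 y ^ p * duhamelKernel α (a.1.1 - a.2) (a.1.2 - y) else 0) ?_
  refine Measurable.ite ?_ ?_ measurable_const
  · exact (measurableSet_lt measurable_const measurable_snd).inter
      (measurableSet_lt measurable_snd (by fun_prop))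
  · refine Measurable.lintegral_prod_right' (f := fun a : ((ℝ × Space N) × ℝ) × Space N =>
      u a.1.2 a.2 ^ p * duhamelKernel α (a.1.1.1 - a.1.2) (a.1.1.2 - a.2)) ?_
    refine Measurable.mul ?_ ?_
    · exact (hu.comp (f := fun a : ((ℝ × Space N) × ℝ) × Space N => (a.1.2, a.2))
        (by fun_prop)).pow_const p
    · exact (measurable_duhamelKernel α).comp
        (f := fun a : ((ℝ × Space N) × ℝ) × Space N => (a.1.1.1 - a.1.2, a.1.1.2 - a.2))
        (by fun_prop)

theorem mildMap_mono {α p : ℝ} (hp : 0 ≤ p) (μ : Measure (Space N)) {u v : ℝ → Space N → ℝ≥0∞}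
    (hu : Measurable fun z : ℝ × Space N => u z.1 z.2)
    (hv : Measurable fun z : ℝ × Space N => v z.1 z.2) (huv : ∀ t x, u t x ≤ v t x) (t : ℝ)
    (x : Space N) : mildMap α p μ u t x ≤ mildMap α p μ v t x := by
  rw [mildMap_eq α p μ hu, mildMap_eq α p μ hv]
  gcongr with z
  exact huv _ _

theorem iSup_rpow {ι : Sort*} (f : ι → ℝ≥0∞) {p : ℝ} (hp : 0 < p) :
    (⨆ i, f i) ^ p = ⨆ i, f i ^ p :=
  (ENNReal.orderIsoRpow p hp).map_iSup f

/-- Monotone convergence; it makes the limit of the iteration an exact fixed point at every `(t,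
x)`. -/
theorem mildMap_iSup {α p : ℝ} (hp : 0 < p) (μ : Measure (Space N))
    {u : ℕ → ℝ → Space N → ℝ≥0∞} (hu : ∀ n, Measurable fun z : ℝ × Space N => u n z.1 z.2)
    (hmono : ∀ n t x, u n t x ≤ u (n + 1) t x) (t : ℝ) (x : Space N) :
    mildMap α p μ (fun t x => ⨆ n, u n t x) t x = ⨆ n, mildMap α p μ (u n) t x := by
  have hk : Measurable fun z : ℝ × Space N => duhamelKernel α (t - z.1) (x - z.2) :=
    (measurable_duhamelKernel α).comp (f := fun z : ℝ × Space N => (t - z.1, x - z.2))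
      (by fun_prop)
  rw [mildMap_eq α p μ (Measurable.iSup hu)]
  simp only [mildMap_eq α p μ (hu _), iSup_rpow _ hp, ENNReal.iSup_mul]
  have hM : Monotone fun n (z : ℝ × Space N) =>
      u n z.1 z.2 ^ p * duhamelKernel α (t - z.1) (x - z.2) := by
    refine monotone_nat_of_le_succ fun n z => ?_
    simp only
    gcongr
    exact hmono _ _ _
  have hm : ∀ n, Measurable fun z : ℝ × Space N =>
      u n z.1 z.2 ^ p * duhamelKernel α (t - z.1) (x - z.2) :=
    fun n => ((hu n).pow_const p).mul hk
  rw [lintegral_iSup hm hM, ENNReal.mul_iSup, ENNReal.add_iSup]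

/-- Minkowski over `μ` itself: every translate of the kernel has the same norm bound, so only the
total mass of `μ` enters. -/
theorem lintegral_opP_rpow_le {p : ℝ} (hp : 1 < p) (hNp : (N : ℝ) / 2 * (p - 1) = 1) {α C m t : ℝ}
    (hC : 0 < C) (ht : 0 < t)
    (hP : ∫⁻ θ in Ioi (0 : ℝ), ENNReal.ofReal (wrightDensity α θ) *
      ENNReal.ofReal (θ ^ (-(1 / p))) ≤ ENNReal.ofReal C)
    (μ : Measure (Space N)) [SFinite μ] (hμ : μ univ ≤ ENNReal.ofReal m) :
    ∫⁻ x, opP α t μ x ^ p ≤ ENNReal.ofReal (m * C * t ^ (-(α / p))) ^ p := by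
  have hw := (measurable_wrightDensity α).ennreal_ofReal
  have hF : Measurable fun z : Space N × Space N =>
      subordKernel (fun θ => ENNReal.ofReal (wrightDensity α θ)) (t ^ α) (z.2 - z.1) :=
    (measurable_subordKernel hw).comp (f := fun z : Space N × Space N => (t ^ α, z.2 - z.1))
      (by fun_prop)
  simp only [opP_eq]
  refine (lintegral_rpow_lintegral_le hp (F := fun y x => subordKernel (fun θ =>
    ENNReal.ofReal (wrightDensity α θ)) (t ^ α) (x - y)) hF
    (b := fun _ => ENNReal.ofReal (C * t ^ (-(α / p)))) measurable_const ?_ ?_ ?_).trans ?_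
  · refine Eventually.of_forall fun _ => ?_
    rw [ne_eq, ENNReal.ofReal_eq_zero, not_le]; positivity
  · exact Eventually.of_forall fun _ => ENNReal.ofReal_ne_top
  · refine Eventually.of_forall fun y => ?_
    refine (lintegral_subordKernel_rpow_le hp hNp hw (by positivity) y).trans ?_
    refine ENNReal.rpow_le_rpow ?_ (by linarith)
    rw [mul_comm C, ENNReal.ofReal_mul (by positivity), ← Real.rpow_mul ht.le,
      show α * -(1 / p) = -(α / p) by ring]
    gcongr
  · rw [lintegral_const, mul_assoc m, mul_comm m, ENNReal.ofReal_mul (q := m) (by positivity)]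
    gcongr

/-- Minkowski over space-time with weight `u ^ p`: the kernel costs `(t - s) ^ (a - 1)` with `a = α
(1 - 1 / p)`, and the weight integrates in space to at most `B ^ p s ^ (-α)`. The time integral
returns the same decay, since `a - α = -α / p`. -/
theorem lintegral_duhamel_rpow_le {p : ℝ} (hp : 1 < p) (hNp : (N : ℝ) / 2 * (p - 1) = 1)
    {α C B t : ℝ} (hα0 : 0 < α) (hα1 : α < 1)
    (hC : 0 < C) (hB : 0 ≤ B) (ht : 0 < t)
    (hS : ∫⁻ θ in Ioi (0 : ℝ), ENNReal.ofReal (θ * wrightDensity α θ) *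
      ENNReal.ofReal (θ ^ (-(1 / p))) ≤ ENNReal.ofReal C)
    {u : ℝ → Space N → ℝ≥0∞} (hu : Measurable fun z : ℝ × Space N => u z.1 z.2)
    (hub : ∀ s, 0 < s → ∫⁻ x, u s x ^ p ≤ ENNReal.ofReal (B * s ^ (-(α / p))) ^ p) :
    ∫⁻ x, (∫⁻ z, u z.1 z.2 ^ p * duhamelKernel α (t - z.1) (x - z.2)
        ∂((volume.restrict (Ioo 0 t)).prod volume)) ^ p
      ≤ ENNReal.ofReal (C * B ^ p * (2 * (1 + 1 / (α * (1 - 1 / p))) / (1 - α))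
        * t ^ (-(α / p))) ^ p := by
  have hp0 : 0 < p := by linarith
  have hw : Measurable fun θ => ENNReal.ofReal (θ * wrightDensity α θ) :=
    (measurable_id.mul (measurable_wrightDensity α)).ennreal_ofReal
  have hip : 1 / p < 1 := by rw [div_lt_one hp0]; exact hp
  have hip0 : 0 < 1 / p := by positivity
  have ha : 0 < α * (1 - 1 / p) := mul_pos hα0 (by linarith)
  have ha1 : α * (1 - 1 / p) < 1 := by nlinarith
  set a := α * (1 - 1 / p) with hadef
  have haα : a - α = -(α / p) := by rw [hadef]; ring
  have hF : Measurable fun z : (ℝ × Space N) × Space N =>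
      duhamelKernel α (t - z.1.1) (z.2 - z.1.2) :=
    (measurable_duhamelKernel α).comp
      (f := fun z : (ℝ × Space N) × Space N => (t - z.1.1, z.2 - z.1.2)) (by fun_prop)
  have hmem : ∀ᵐ z : ℝ × Space N ∂((volume.restrict (Ioo 0 t)).prod volume), z.1 ∈ Ioo 0 t :=
    Measure.quasiMeasurePreserving_fst.ae (ae_restrict_mem measurableSet_Ioo)
  refine (lintegral_rpow_lintegral_mul_le hp (w := fun z : ℝ × Space N => u z.1 z.2 ^ p)
    (hu.pow_const p) (F := fun z x => duhamelKernel α (t - z.1) (x - z.2)) hF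
    (b := fun z => ENNReal.ofReal (C * (t - z.1) ^ (a - 1))) (by fun_prop) ?_ ?_ ?_).trans ?_
  · filter_upwards [hmem] with z hz
    have : 0 < t - z.1 := by linarith [hz.2]
    rw [ne_eq, ENNReal.ofReal_eq_zero, not_le]; positivity
  · exact Eventually.of_forall fun _ => ENNReal.ofReal_ne_top
  · filter_upwards [hmem] with z hz
    have hτ : 0 < t - z.1 := by linarith [hz.2]
    have hk := lintegral_subordKernel_rpow_le hp hNp hw
      (σ := (t - z.1) ^ α) (by positivity) z.2
    have hmk : Measurable fun x : Space N =>
        subordKernel (fun θ => ENNReal.ofReal (θ * wrightDensity α θ)) ((t - z.1) ^ α)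
          (x - z.2) :=
      (measurable_subordKernel hw).comp (f := fun x : Space N => ((t - z.1) ^ α, x - z.2))
        (by fun_prop)
    unfold duhamelKernel
    simp only [ENNReal.mul_rpow_of_nonneg _ _ hp0.le]
    rw [lintegral_const_mul _ (hmk.pow_const p)]
    calc _ ≤ ENNReal.ofReal ((t - z.1) ^ (α - 1)) ^ p *
          (ENNReal.ofReal (((t - z.1) ^ α) ^ (-(1 / p))) * ENNReal.ofReal C) ^ p := by
          refine mul_le_mul_right (hk.trans (ENNReal.rpow_le_rpow ?_ hp0.le)) _
          exact mul_le_mul_right hS _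
      _ = _ := by
          rw [← ENNReal.mul_rpow_of_nonneg _ _ hp0.le, ← ENNReal.ofReal_mul (by positivity),
            ← ENNReal.ofReal_mul (by positivity), ← Real.rpow_mul hτ.le, ← mul_assoc,
            ← Real.rpow_add hτ]
          rw [mul_comm C, show α - 1 + α * -(1 / p) = a - 1 by rw [hadef]; ring]
  · refine ENNReal.rpow_le_rpow ?_ hp0.le
    have hmb : Measurable fun z : ℝ × Space N =>
        u z.1 z.2 ^ p * ENNReal.ofReal (C * (t - z.1) ^ (a - 1)) :=
      (hu.pow_const p).mul (by fun_prop)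
    rw [lintegral_prod _ hmb.aemeasurable]
    calc _ ≤ ∫⁻ s in Ioo 0 t, ENNReal.ofReal (C * B ^ p) *
          (ENNReal.ofReal ((t - s) ^ (a - 1)) * ENNReal.ofReal (s ^ (-α))) := by
          refine setLIntegral_mono' measurableSet_Ioo fun s hs => ?_
          have hs0 : 0 < s := hs.1
          have hτ : 0 < t - s := by linarith [hs.2]
          have hus : Measurable fun y => u s y ^ p := (hu.comp measurable_prodMk_left).pow_const p
          simp only
          rw [lintegral_mul_const _ hus]
          refine (mul_le_mul_left (hub s hs0) _).trans (le_of_eq ?_)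
          rw [ENNReal.ofReal_rpow_of_nonneg (by positivity) hp0.le,
            Real.mul_rpow hB (by positivity), ← Real.rpow_mul hs0.le,
            show -(α / p) * p = -α by field_simp, ← ENNReal.ofReal_mul (by positivity),
            ← ENNReal.ofReal_mul (by positivity), ← ENNReal.ofReal_mul (by positivity)]
          congr 1; ring
      _ ≤ _ := by
          rw [lintegral_const_mul _ (by fun_prop), mul_assoc,
            ← haα, ENNReal.ofReal_mul
              (q := 2 * (1 + 1 / a) / (1 - α) * t ^ (a - α)) (by positivity)]
          exact mul_le_mul_right (setLIntegral_beta_le ha ha1 hα0 hα1 ht) _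

/-- Invariance of a ball in the scale-invariant norm. The radius `2 * m * C` is twice the linear
contribution, and `hsmall` keeps the Duhamel contribution below the other half. -/
theorem lintegral_mildMap_rpow_le {p : ℝ} (hp : 1 < p) (hNp : (N : ℝ) / 2 * (p - 1) = 1)
    {α C m t : ℝ} (hα0 : 0 < α) (hα1 : α < 1) (hC : 0 < C) (hm : 0 ≤ m) (ht : 0 < t)
    (hP : ∫⁻ θ in Ioi (0 : ℝ), ENNReal.ofReal (wrightDensity α θ) *
      ENNReal.ofReal (θ ^ (-(1 / p))) ≤ ENNReal.ofReal C)
    (hS : ∫⁻ θ in Ioi (0 : ℝ), ENNReal.ofReal (θ * wrightDensity α θ) *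
      ENNReal.ofReal (θ ^ (-(1 / p))) ≤ ENNReal.ofReal C)
    (hsmall : (2 * m * C) ^ p * (2 * (1 + 1 / (α * (1 - 1 / p))) / (1 - α)) ≤ m)
    (μ : Measure (Space N)) [SFinite μ] (hμ : μ univ ≤ ENNReal.ofReal m)
    {u : ℝ → Space N → ℝ≥0∞} (hu : Measurable fun z : ℝ × Space N => u z.1 z.2)
    (hub : ∀ s, 0 < s → ∫⁻ x, u s x ^ p ≤ ENNReal.ofReal (2 * m * C * s ^ (-(α / p))) ^ p) :
    ∫⁻ x, mildMap α p μ u t x ^ p ≤ ENNReal.ofReal (2 * m * C * t ^ (-(α / p))) ^ p := by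
  have hp0 : 0 < p := by linarith
  have h1 := lintegral_opP_rpow_le hp hNp hC ht hP μ hμ
  have h2 := lintegral_duhamel_rpow_le hp hNp hα0 hα1 hC (B := 2 * m * C) (by positivity) ht hS hu hub
  have hip : 1 / p < 1 := by rw [div_lt_one hp0]; exact hp
  have hβ : 0 < 1 - α := by linarith
  have ha : 0 < α * (1 - 1 / p) := mul_pos hα0 (by linarith)
  set K := 2 * (1 + 1 / (α * (1 - 1 / p))) / (1 - α) with hK
  have hK0 : 0 ≤ K := by positivity
  set J : Space N → ℝ≥0∞ := fun x => ∫⁻ z, u z.1 z.2 ^ p * duhamelKernel α (t - z.1) (x - z.2)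
        ∂((volume.restrict (Ioo 0 t)).prod volume) with hJ
  have hJm : Measurable J := by
    refine Measurable.lintegral_prod_right' (f := fun a : Space N × (ℝ × Space N) =>
      u a.2.1 a.2.2 ^ p * duhamelKernel α (t - a.2.1) (a.1 - a.2.2)) ?_
    refine ((hu.comp measurable_snd).pow_const p).mul ?_
    exact (measurable_duhamelKernel α).comp
      (f := fun a : Space N × (ℝ × Space N) => (t - a.2.1, a.1 - a.2.2)) (by fun_prop)
  have hPm : Measurable fun x => opP α t μ x := by
    simp only [opP_eq]
    refine Measurable.lintegral_prod_right' (f := fun a : Space N × Space N =>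
      subordKernel (fun θ => ENNReal.ofReal (wrightDensity α θ)) (t ^ α) (a.1 - a.2)) ?_
    exact (measurable_subordKernel (measurable_wrightDensity α).ennreal_ofReal).comp
      (f := fun a : Space N × Space N => (t ^ α, a.1 - a.2)) (by fun_prop)
  have hle : ∀ x, mildMap α p μ u t x ≤ (fun x => opP α t μ x) x + J x := by
    intro x
    rw [mildMap_eq α p μ hu]
    refine add_le_add_right (mul_le_of_le_one_left' ?_) _
    rw [← ENNReal.ofReal_one]
    exact ENNReal.ofReal_le_ofReal hα1.le
  have hmk := ENNReal.lintegral_Lp_add_le (μ := volume) hPm.aemeasurable hJm.aemeasurable hp.le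
  have r1 : (∫⁻ x, opP α t μ x ^ p) ^ (1 / p) ≤ ENNReal.ofReal (m * C * t ^ (-(α / p))) := by
    refine (ENNReal.rpow_le_rpow h1 (by positivity)).trans (le_of_eq ?_)
    rw [← ENNReal.rpow_mul, mul_one_div_cancel hp0.ne', ENNReal.rpow_one]
  have r2 : (∫⁻ x, J x ^ p) ^ (1 / p)
      ≤ ENNReal.ofReal (C * (2 * m * C) ^ p * K * t ^ (-(α / p))) := by
    refine (ENNReal.rpow_le_rpow h2 (by positivity)).trans (le_of_eq ?_)
    rw [← ENNReal.rpow_mul, mul_one_div_cancel hp0.ne', ENNReal.rpow_one]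
  calc ∫⁻ x, mildMap α p μ u t x ^ p
      ≤ ∫⁻ x, ((fun x => opP α t μ x) + J) x ^ p :=
        lintegral_mono fun x => ENNReal.rpow_le_rpow (hle x) hp0.le
    _ = ((∫⁻ x, ((fun x => opP α t μ x) + J) x ^ p) ^ (1 / p)) ^ p := by
        rw [← ENNReal.rpow_mul, one_div_mul_cancel hp0.ne', ENNReal.rpow_one]
    _ ≤ _ := by
        refine ENNReal.rpow_le_rpow ((hmk.trans (add_le_add r1 r2)).trans ?_) hp0.le
        rw [← ENNReal.ofReal_add (by positivity) (by positivity)]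
        refine ENNReal.ofReal_le_ofReal ?_
        have : C * (2 * m * C) ^ p * K ≤ C * m := by
          rw [mul_assoc]; gcongr
        calc _ = (m * C + C * (2 * m * C) ^ p * K) * t ^ (-(α / p)) := by ring
          _ ≤ (m * C + C * m) * t ^ (-(α / p)) := by gcongr
          _ = _ := by ring

/-- Global existence for small mass, by monotone iteration. -/
theorem exists_isGlobalSolution {p : ℝ} (hp : 1 < p) (hNp : (N : ℝ) / 2 * (p - 1) = 1)
    {α C m : ℝ} (hα0 : 0 < α) (hα1 : α < 1) (hC : 0 < C) (hm : 0 ≤ m)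
    (hP : ∫⁻ θ in Ioi (0 : ℝ), ENNReal.ofReal (wrightDensity α θ) *
      ENNReal.ofReal (θ ^ (-(1 / p))) ≤ ENNReal.ofReal C)
    (hS : ∫⁻ θ in Ioi (0 : ℝ), ENNReal.ofReal (θ * wrightDensity α θ) *
      ENNReal.ofReal (θ ^ (-(1 / p))) ≤ ENNReal.ofReal C)
    (hsmall : (2 * m * C) ^ p * (2 * (1 + 1 / (α * (1 - 1 / p))) / (1 - α)) ≤ m)
    (μ : Measure (Space N)) [SFinite μ] (hμ : μ univ ≤ ENNReal.ofReal m) :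
    ∃ u : ℝ → Space N → ℝ≥0∞, IsGlobalSolution α p μ u := by
  have hp0 : 0 < p := by linarith
  -- Picard iteration from `0`: positivity of the map makes the sequence increase, so no contraction
  -- estimate is needed.
  let u : ℕ → ℝ → Space N → ℝ≥0∞ := fun n =>
    Nat.rec (fun _ _ => 0) (fun _ v => mildMap α p μ v) n
  have hsucc : ∀ n, u (n + 1) = mildMap α p μ (u n) := fun n => rfl
  have hmeas : ∀ n, Measurable fun z : ℝ × Space N => u n z.1 z.2 := by
    intro n
    induction n with
    | zero => exact measurable_const
    | succ n ih => rw [hsucc]; exact measurable_mildMap α p μ ih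
  have hmono : ∀ n t x, u n t x ≤ u (n + 1) t x := by
    intro n
    induction n with
    | zero => intro t x; exact zero_le
    | succ n ih =>
      intro t x
      rw [hsucc, hsucc (n + 1)]
      exact mildMap_mono hp0.le μ (hmeas n) (hmeas (n + 1)) ih t x
  have hbd : ∀ n t, 0 < t →
      ∫⁻ x, u n t x ^ p ≤ ENNReal.ofReal (2 * m * C * t ^ (-(α / p))) ^ p := by
    intro n
    induction n with
    | zero => intro t _; simp [u, ENNReal.zero_rpow_of_pos hp0]
    | succ n ih =>
      intro t ht
      rw [hsucc]
      exact lintegral_mildMap_rpow_le hp hNp hα0 hα1 hC hm ht hP hS hsmall μ hμ (hmeas n) ih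
  have hUmeas : Measurable fun z : ℝ × Space N => ⨆ n, u n z.1 z.2 := Measurable.iSup hmeas
  refine ⟨fun t x => ⨆ n, u n t x, fun T _ => ⟨hUmeas, Eventually.of_forall fun t ht => ?_⟩⟩
  have hfix : ∀ x, (⨆ n, u n t x) = mildMap α p μ (fun t x => ⨆ n, u n t x) t x := by
    intro x
    rw [mildMap_iSup hp0 μ hmeas hmono]
    have hM : Monotone fun n => u n t x := monotone_nat_of_le_succ fun n => hmono n t x
    exact (hM.iSup_nat_add 1).symm
  -- The fixed-point identity may read `∞ = ∞` at some points; the uniform norm bound confines these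
  -- to a null set for each `t`.
  have hfin : ∫⁻ x, (⨆ n, u n t x) ^ p < ∞ := by
    simp only [iSup_rpow _ hp0]
    have hm' : ∀ n, Measurable fun x => u n t x ^ p :=
      fun n => ((hmeas n).comp measurable_prodMk_left).pow_const p
    rw [lintegral_iSup hm']
    · exact (iSup_le fun n => hbd n t ht.1).trans_lt
        (ENNReal.rpow_lt_top_of_nonneg hp0.le ENNReal.ofReal_ne_top)
    · exact monotone_nat_of_le_succ fun n x => ENNReal.rpow_le_rpow (hmono n t x) hp0.le
  filter_upwards [ae_lt_top ((hUmeas.comp measurable_prodMk_left).pow_const p) hfin.ne] with x hx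
  refine ⟨?_, hfix x⟩
  by_contra h
  rw [not_lt, top_le_iff] at h
  simp only [Function.comp_apply, h, ENNReal.top_rpow_of_pos hp0, lt_self_iff_false] at hx

end Existence

/-! ### Lower bounds for global solutions and the bootstrap. -/

section Necessity

variable {N : ℕ}

/-- The constant in the pointwise lower bound for subordinated heat kernels. -/
noncomputable def kernelConst (N : ℕ) (k : ℝ) : ℝ :=
  ((6 * Real.pi) ^ ((N : ℝ) / 2))⁻¹ * Real.exp (-(k / 2)) * (1 / 4)

theorem kernelConst_pos (N : ℕ) (k : ℝ) : 0 < kernelConst N k := by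
  have := Real.pi_pos
  unfold kernelConst; positivity

/-- Only `θ ∈ [1/2, 3/2]` is kept: there `4πσθ ≤ 6πσ` and `|z| ^ 2 / (4σθ) ≤ k / 2`, and the weight
has mass at least `1/4`. -/
theorem le_subordKernel {w : ℝ → ℝ≥0∞} {σ k : ℝ} (hσ : 0 < σ)
    (hw : Measurable w)
    (hwl : ENNReal.ofReal (1 / 4) ≤ ∫⁻ θ in Icc (1 / 2 : ℝ) (3 / 2), w θ) {z : Space N}
    (hz : ‖z‖ ^ 2 ≤ k * σ) :
    ENNReal.ofReal (kernelConst N k * σ ^ (-((N : ℝ) / 2))) ≤ subordKernel w σ z := by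
  have hpi := Real.pi_pos
  set c := ((6 * Real.pi) ^ ((N : ℝ) / 2))⁻¹ * Real.exp (-(k / 2)) * σ ^ (-((N : ℝ) / 2)) with hc
  have hc0 : 0 ≤ c := by positivity
  have hpt : ∀ θ ∈ Icc (1 / 2 : ℝ) (3 / 2), c ≤ heatKernel (σ * θ) z := by
    intro θ hθ
    have hθ0 : 0 < θ := by linarith [hθ.1]
    unfold heatKernel
    have e1 : c = 1 / (6 * Real.pi * σ) ^ ((N : ℝ) / 2) * Real.exp (-(k / 2)) := by
      rw [hc, Real.mul_rpow (by positivity) hσ.le, Real.rpow_neg hσ.le]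
      field_simp
    rw [e1]
    gcongr ?_ * Real.exp ?_
    · refine one_div_le_one_div_of_le (by positivity) (Real.rpow_le_rpow (by positivity) ?_
        (by positivity))
      have : 0 < Real.pi * σ := by positivity
      nlinarith [hθ.2]
    · rw [neg_div, neg_le_neg_iff, div_le_iff₀ (by positivity)]
      have hk : 0 ≤ k * σ := (sq_nonneg _).trans hz
      nlinarith [hθ.1]
  have hsub : Icc (1 / 2 : ℝ) (3 / 2) ⊆ Ioi 0 := fun θ hθ => mem_Ioi.mpr (by linarith [hθ.1])
  calc ENNReal.ofReal (kernelConst N k * σ ^ (-((N : ℝ) / 2)))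
      = ENNReal.ofReal (1 / 4) * ENNReal.ofReal c := by
        rw [← ENNReal.ofReal_mul (by norm_num)]
        congr 1; rw [hc, kernelConst]; ring
    _ ≤ (∫⁻ θ in Icc (1 / 2 : ℝ) (3 / 2), w θ) * ENNReal.ofReal c := by gcongr
    _ = ∫⁻ θ in Icc (1 / 2 : ℝ) (3 / 2), w θ * ENNReal.ofReal c := (lintegral_mul_const _ hw).symm
    _ ≤ ∫⁻ θ in Icc (1 / 2 : ℝ) (3 / 2), w θ * ENNReal.ofReal (heatKernel (σ * θ) z) := by
        refine setLIntegral_mono' measurableSet_Icc fun θ hθ => ?_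
        gcongr
        exact hpt θ hθ
    _ ≤ _ := lintegral_mono_set hsub

theorem quarter_le_lintegral_mul_wrightDensity {α : ℝ}
    (h : ENNReal.ofReal (1 / 2) ≤
      ∫⁻ θ in Icc (1 / 2 : ℝ) (3 / 2), ENNReal.ofReal (wrightDensity α θ)) :
    ENNReal.ofReal (1 / 4) ≤
      ∫⁻ θ in Icc (1 / 2 : ℝ) (3 / 2), ENNReal.ofReal (θ * wrightDensity α θ) := by
  have hw := measurable_wrightDensity α
  calc ENNReal.ofReal (1 / 4) = ENNReal.ofReal (1 / 2) * ENNReal.ofReal (1 / 2) := by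
        rw [← ENNReal.ofReal_mul (by norm_num)]; norm_num
    _ ≤ ENNReal.ofReal (1 / 2) *
        ∫⁻ θ in Icc (1 / 2 : ℝ) (3 / 2), ENNReal.ofReal (wrightDensity α θ) := by gcongr
    _ = ∫⁻ θ in Icc (1 / 2 : ℝ) (3 / 2), ENNReal.ofReal (1 / 2) *
        ENNReal.ofReal (wrightDensity α θ) := (lintegral_const_mul _ (by fun_prop)).symm
    _ ≤ _ := by
        refine setLIntegral_mono' measurableSet_Icc fun θ hθ => ?_
        have hθ0 : 0 ≤ θ := by linarith [hθ.1]
        rw [ENNReal.ofReal_mul hθ0]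
        gcongr
        exact hθ.1

/-- The volume of the unit ball. -/
noncomputable def unitBallVolume (N : ℕ) : ℝ := (volume (Metric.ball (0 : Space N) 1)).toReal

theorem unitBallVolume_pos (N : ℕ) : 0 < unitBallVolume N :=
  ENNReal.toReal_pos (Metric.measure_ball_pos volume _ one_pos).ne' measure_ball_lt_top.ne

theorem volume_closedBall_eq (x : Space N) {r : ℝ} (hr : 0 ≤ r) :
    volume (Metric.closedBall x r) = ENNReal.ofReal (r ^ N * unitBallVolume N) := by
  rw [Measure.addHaar_closedBall _ _ hr, finrank_euclideanSpace_fin,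
    ENNReal.ofReal_mul (by positivity), unitBallVolume, ENNReal.ofReal_toReal measure_ball_lt_top.ne]

theorem sqrt_pow_eq_rpow {σ : ℝ} (hσ : 0 ≤ σ) : √σ ^ N = σ ^ ((N : ℝ) / 2) := by
  rw [Real.sqrt_eq_rpow, ← Real.rpow_natCast, ← Real.rpow_mul hσ]
  congr 1; ring

/-- A lower bound for the subordinated semigroup applied to the indicator of a ball, at a point of
that ball. -/
theorem le_setLIntegral_subordKernel_closedBall {w : ℝ → ℝ≥0∞} {σ ρ : ℝ} (hσ : 0 < σ)
    (hw : Measurable w)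
    (hwl : ENNReal.ofReal (1 / 4) ≤ ∫⁻ θ in Icc (1 / 2 : ℝ) (3 / 2), w θ) (hρ : √σ ≤ ρ)
    {x : Space N} (hx : ‖x‖ ≤ ρ) :
    ENNReal.ofReal (kernelConst N 1 * (unitBallVolume N / 2 ^ N)) ≤
      ∫⁻ y in Metric.closedBall 0 ρ, subordKernel w σ (x - y) := by
  have hs : 0 < √σ := Real.sqrt_pos.mpr hσ
  have hρ0 : 0 < ρ := hs.trans_le hρ
  -- Near the boundary of the large ball, a ball around `x` would stick out. Contracting the centre
  -- by `1 - ε` leaves room `ερ = √σ / 2`, and moves it by at most `√σ / 2`, so all points used stay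
  -- within `√σ` of `x`.
  set ε := √σ / (2 * ρ) with hε
  have hε0 : 0 ≤ ε := by positivity
  have hερ : ε * ρ = √σ / 2 := by rw [hε]; field_simp
  have hε1 : ε ≤ 1 := by rw [hε, div_le_one (by positivity)]; linarith
  have hεx : ε * ‖x‖ ≤ √σ / 2 := by rw [← hερ]; gcongr
  have hsub : Metric.closedBall ((1 - ε) • x) (√σ / 2) ⊆ Metric.closedBall 0 ρ := by
    intro y hy
    rw [mem_closedBall_iff_norm] at hy
    rw [mem_closedBall_zero_iff]
    have h1 : ‖(1 - ε) • x‖ = (1 - ε) * ‖x‖ := by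
      rw [norm_smul, Real.norm_of_nonneg (by linarith)]
    have h2 : (1 - ε) * ‖x‖ ≤ (1 - ε) * ρ := by gcongr
    have h3 : ‖y‖ ≤ ‖y - (1 - ε) • x‖ + ‖(1 - ε) • x‖ := by
      simpa using norm_add_le (y - (1 - ε) • x) ((1 - ε) • x)
    nlinarith
  have hK : ∀ y ∈ Metric.closedBall ((1 - ε) • x) (√σ / 2),
      ENNReal.ofReal (kernelConst N 1 * σ ^ (-((N : ℝ) / 2))) ≤ subordKernel w σ (x - y) := by
    intro y hy
    rw [mem_closedBall_iff_norm] at hy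
    refine le_subordKernel hσ hw hwl ?_
    have h1 : ‖x - y‖ ≤ ε * ‖x‖ + ‖y - (1 - ε) • x‖ := by
      have e : x - y = ε • x - (y - (1 - ε) • x) := by module
      rw [e]
      refine (norm_sub_le _ _).trans (le_of_eq ?_)
      rw [norm_smul, Real.norm_of_nonneg hε0]
    have h2 : ‖x - y‖ ≤ √σ := by linarith
    calc ‖x - y‖ ^ 2 ≤ √σ ^ 2 := by gcongr
      _ = 1 * σ := by rw [Real.sq_sqrt hσ.le, one_mul]
  calc _ = ENNReal.ofReal (kernelConst N 1 * σ ^ (-((N : ℝ) / 2))) *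
        volume (Metric.closedBall ((1 - ε) • x) (√σ / 2)) := by
        have := kernelConst_pos N 1
        rw [volume_closedBall_eq _ (by positivity), ← ENNReal.ofReal_mul (by positivity), div_pow,
          sqrt_pow_eq_rpow hσ.le, Real.rpow_neg hσ.le]
        congr 1
        have : σ ^ ((N : ℝ) / 2) ≠ 0 := by positivity
        field_simp
    _ = ∫⁻ _ in Metric.closedBall ((1 - ε) • x) (√σ / 2),
          ENNReal.ofReal (kernelConst N 1 * σ ^ (-((N : ℝ) / 2))) := (setLIntegral_const _ _).symm
    _ ≤ ∫⁻ y in Metric.closedBall ((1 - ε) • x) (√σ / 2), subordKernel w σ (x - y) :=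
        setLIntegral_mono' Metric.isClosed_closedBall.measurableSet hK
    _ ≤ _ := lintegral_mono_set hsub

/-- `u` satisfies the integral equation for almost all positive times. -/
theorem IsGlobalSolution.ae_eq_mildMap {α p : ℝ} {ν : Measure (Space N)}
    {u : ℝ → Space N → ℝ≥0∞} (h : IsGlobalSolution α p ν u) :
    ∀ᵐ t : ℝ, 0 < t → ∀ᵐ x : Space N, u t x < ∞ ∧ u t x = mildMap α p ν u t x := by
  -- Integer horizons suffice, and their countably many exceptional sets have null union.
  have h' : ∀ n : ℕ, _ := fun n : ℕ => (h (n + 1) (by positivity)).2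
  filter_upwards [ae_all_iff.mpr h'] with t ht h0
  obtain ⟨n, hn⟩ := exists_nat_ge t
  exact ht n ⟨h0, by linarith⟩

/-- By positivity, the linear term and the times outside `(a, b)` can be discarded. -/
theorem le_mildMap_of_le {α p t a b : ℝ} (ha : 0 ≤ a) (hb : b ≤ t) (ν : Measure (Space N))
    {u : ℝ → Space N → ℝ≥0∞} (hu : Measurable fun z : ℝ × Space N => u z.1 z.2)
    {g : ℝ → ℝ≥0∞} {x : Space N}
    (hg : ∀ᵐ s : ℝ, s ∈ Ioo a b → g s ≤ ∫⁻ y, u s y ^ p *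
      subordKernel (fun θ => ENNReal.ofReal (θ * wrightDensity α θ)) ((t - s) ^ α) (x - y)) :
    ENNReal.ofReal α * ∫⁻ s in Ioo a b, ENNReal.ofReal ((t - s) ^ (α - 1)) * g s
      ≤ mildMap α p ν u t x := by
  unfold mildMap
  refine le_add_left (mul_le_mul_right ?_ _)
  refine le_trans ?_ (lintegral_mono_set (Ioo_subset_Ioo ha hb))
  refine lintegral_mono_ae ?_
  refine (ae_restrict_iff' measurableSet_Ioo).mpr ?_
  filter_upwards [hg] with s hs hsm
  have hus : Measurable fun y => u s y ^ p := (hu.comp measurable_prodMk_left).pow_const p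
  have hk : Measurable fun y : Space N =>
      subordKernel (fun θ => ENNReal.ofReal (θ * wrightDensity α θ)) ((t - s) ^ α) (x - y) :=
    (measurable_subordKernel (measurable_id.mul (measurable_wrightDensity α)).ennreal_ofReal).comp
      (f := fun y : Space N => ((t - s) ^ α, x - y)) (by fun_prop)
  rw [opS_eq, lintegral_withDensity_eq_lintegral_mul _ hus hk]
  exact mul_le_mul_right (hs hsm) _

/-- `u ≥ A t^{-αN/2}` for `|x| ≤ t^{α/2}` and `t ≥ t₀`. -/
def ParabolicLowerBound (α : ℝ) (u : ℝ → Space N → ℝ≥0∞) (A t₀ : ℝ) : Prop :=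
  ∀ᵐ t : ℝ, t₀ ≤ t → ∀ᵐ x : Space N, ‖x‖ ^ 2 ≤ t ^ α →
    ENNReal.ofReal (A * (t ^ α) ^ (-((N : ℝ) / 2))) ≤ u t x

theorem norm_sub_sq_le (x y : Space N) : ‖x - y‖ ^ 2 ≤ 2 * (‖x‖ ^ 2 + ‖y‖ ^ 2) := by
  have h := norm_sub_le x y
  have h0 := norm_nonneg (x - y)
  nlinarith [sq_nonneg (‖x‖ - ‖y‖)]

/-- The linear term alone suffices. From `t₀` on the ball of radius `R` lies in the parabolic ball,
so `|x - y| ^ 2 ≤ 4 t ^ α`; hence `kernelConst N 4`. -/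
theorem parabolicLowerBound_of_measure {α p : ℝ} (hα0 : 0 < α)
    (hconc : ENNReal.ofReal (1 / 2) ≤
      ∫⁻ θ in Icc (1 / 2 : ℝ) (3 / 2), ENNReal.ofReal (wrightDensity α θ))
    {ν : Measure (Space N)} [SFinite ν] {u : ℝ → Space N → ℝ≥0∞}
    (hsol : ∀ᵐ t : ℝ, 0 < t → ∀ᵐ x : Space N, u t x < ∞ ∧ u t x = mildMap α p ν u t x)
    {R m t₀ : ℝ} (hR : R ^ 2 ≤ t₀ ^ α) (ht₀ : 0 < t₀)
    (hν : ENNReal.ofReal m ≤ ν (Metric.closedBall 0 R)) :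
    ParabolicLowerBound α u (kernelConst N 4 * m) t₀ := by
  filter_upwards [hsol] with t ht htt
  have ht0 : 0 < t := ht₀.trans_le htt
  filter_upwards [ht ht0] with x hx hxt
  rw [hx.2, mildMap]
  refine le_add_right ?_
  rw [opP_eq]
  have hR' : R ^ 2 ≤ t ^ α := hR.trans (Real.rpow_le_rpow ht₀.le htt hα0.le)
  have hk := kernelConst_pos N 4
  calc _ = ENNReal.ofReal (kernelConst N 4 * (t ^ α) ^ (-((N : ℝ) / 2))) * ENNReal.ofReal m := by
        rw [← ENNReal.ofReal_mul (by positivity)]; congr 1; ring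
    _ ≤ ENNReal.ofReal (kernelConst N 4 * (t ^ α) ^ (-((N : ℝ) / 2))) *
        ν (Metric.closedBall 0 R) := by gcongr
    _ = ∫⁻ _ in Metric.closedBall 0 R,
        ENNReal.ofReal (kernelConst N 4 * (t ^ α) ^ (-((N : ℝ) / 2))) ∂ν :=
        (setLIntegral_const _ _).symm
    _ ≤ ∫⁻ y in Metric.closedBall 0 R,
        subordKernel (fun θ => ENNReal.ofReal (wrightDensity α θ)) (t ^ α) (x - y) ∂ν := by
        refine setLIntegral_mono' Metric.isClosed_closedBall.measurableSet fun y hy => ?_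
        refine le_subordKernel (by positivity) (measurable_wrightDensity α).ennreal_ofReal
          ((ENNReal.ofReal_le_ofReal (by norm_num)).trans hconc) ?_
        rw [mem_closedBall_zero_iff] at hy
        have h1 := norm_sub_sq_le x y
        have h2 : ‖y‖ ^ 2 ≤ R ^ 2 := by gcongr
        linarith
    _ ≤ _ := setLIntegral_le_lintegral _ _

/-- The gain constant in the bootstrap step. -/
noncomputable def gainConst (N : ℕ) : ℝ := kernelConst N 8 * unitBallVolume N / 8

theorem gainConst_pos (N : ℕ) : 0 < gainConst N := by
  have := kernelConst_pos N 8
  have := unitBallVolume_pos N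
  unfold gainConst; positivity

/-- For `s` in `(t₀, t / 2)` the kernel is comparable to `t ^ (-αN / 2)` and `(t - s) ^ (α - 1) ≥ t
^ (α - 1)`, while the nonlinearity integrates in space to at least a multiple of `A ^ p s ^ (-α)`.
Once `t` is far beyond `t₀`, the integral of `s ^ (-α)` over this range is a fixed fraction of `t ^
(1 - α) / (1 - α)`. -/
theorem parabolicLowerBound_step {α p : ℝ} (hα0 : 1 / 2 < α) (hα1 : α < 1)
    (hp : 1 < p) (hNp : (N : ℝ) / 2 * (p - 1) = 1)
    (hconc : ENNReal.ofReal (1 / 2) ≤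
      ∫⁻ θ in Icc (1 / 2 : ℝ) (3 / 2), ENNReal.ofReal (wrightDensity α θ))
    {ν : Measure (Space N)} {u : ℝ → Space N → ℝ≥0∞}
    (hu : Measurable fun z : ℝ × Space N => u z.1 z.2)
    (hsol : ∀ᵐ t : ℝ, 0 < t → ∀ᵐ x : Space N, u t x < ∞ ∧ u t x = mildMap α p ν u t x)
    {A t₀ : ℝ} (hA : 0 ≤ A) (ht₀ : 0 < t₀) (hlow : ParabolicLowerBound α u A t₀) :
    ParabolicLowerBound α u (gainConst N * A ^ p / (1 - α)) (2 * 2 ^ (1 / (1 - α)) * t₀) := by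
  have hβ : 0 < 1 - α := by linarith
  have hp0 : 0 < p := by linarith
  have hα : 0 < α := by linarith
  have hω := unitBallVolume_pos N
  have hk := kernelConst_pos N 8
  have hw : Measurable fun θ => ENNReal.ofReal (θ * wrightDensity α θ) :=
    (measurable_id.mul (measurable_wrightDensity α)).ennreal_ofReal
  have h2 : (1 : ℝ) ≤ 2 ^ (1 / (1 - α)) := Real.one_le_rpow (by norm_num) (by positivity)
  filter_upwards [hsol] with t ht htt
  have hL : 2 ^ (1 / (1 - α)) * t₀ ≤ t / 2 := by linarith
  have ht2 : t₀ ≤ t / 2 := le_trans (by nlinarith) hL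
  have ht0 : 0 < t := by linarith
  filter_upwards [ht ht0] with x hx hxt
  rw [hx.2]
  -- The `8` comes from `|x - y| ^ 2 ≤ 2 (t ^ α + s ^ α) ≤ 4 t ^ α ≤ 8 (t - s) ^ α`, using `s ≤ t /
  -- 2`.
  set K := kernelConst N 8 * (t ^ α) ^ (-((N : ℝ) / 2)) with hK
  have hK0 : 0 < K := by positivity
  have hinner : ∀ᵐ s : ℝ, s ∈ Ioo t₀ (t / 2) →
      ENNReal.ofReal (A ^ p * K * unitBallVolume N * s ^ (-α)) ≤ ∫⁻ y, u s y ^ p *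
      subordKernel (fun θ => ENNReal.ofReal (θ * wrightDensity α θ)) ((t - s) ^ α) (x - y) := by
    filter_upwards [hlow] with s hs hsm
    have hs0 : 0 < s := ht₀.trans hsm.1
    have hsα : 0 < s ^ α := by positivity
    have hts : t / 2 < t - s := by linarith [hsm.2]
    have hts0 : 0 < t - s := by linarith
    have hpt : ∀ᵐ y : Space N, y ∈ Metric.closedBall 0 √(s ^ α) →
        ENNReal.ofReal (A * (s ^ α) ^ (-((N : ℝ) / 2))) ^ p * ENNReal.ofReal K ≤ u s y ^ p *
        subordKernel (fun θ => ENNReal.ofReal (θ * wrightDensity α θ)) ((t - s) ^ α) (x - y) := by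
      filter_upwards [hs hsm.1.le] with y hy hym
      rw [mem_closedBall_zero_iff] at hym
      have hy2 : ‖y‖ ^ 2 ≤ s ^ α := by
        calc ‖y‖ ^ 2 ≤ √(s ^ α) ^ 2 := by gcongr
          _ = s ^ α := Real.sq_sqrt hsα.le
      refine mul_le_mul' (ENNReal.rpow_le_rpow (hy hy2) hp0.le) ?_
      refine le_trans ?_ (le_subordKernel (k := 8) (by positivity) hw
        (quarter_le_lintegral_mul_wrightDensity hconc) ?_)
      · refine ENNReal.ofReal_le_ofReal ?_
        rw [hK]
        refine mul_le_mul_of_nonneg_left ?_ hk.le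
        refine Real.rpow_le_rpow_of_nonpos (by positivity) ?_ (by simp; positivity)
        exact Real.rpow_le_rpow hts0.le (by linarith) hα.le
      · have h1 := norm_sub_sq_le x y
        have h3 : s ^ α ≤ t ^ α := Real.rpow_le_rpow hs0.le (by linarith [hsm.2]) hα.le
        have h4 : t ^ α ≤ 2 * (t - s) ^ α := by
          calc t ^ α ≤ (2 * (t - s)) ^ α := Real.rpow_le_rpow ht0.le (by linarith) hα.le
            _ = 2 ^ α * (t - s) ^ α := Real.mul_rpow (by norm_num) hts0.le
            _ ≤ 2 ^ (1 : ℝ) * (t - s) ^ α := by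
              gcongr
              norm_num
            _ = _ := by rw [Real.rpow_one]
        linarith
    calc _ = ENNReal.ofReal (A * (s ^ α) ^ (-((N : ℝ) / 2))) ^ p * ENNReal.ofReal K *
          volume (Metric.closedBall (0 : Space N) √(s ^ α)) := by
          rw [volume_closedBall_eq _ (by positivity), sqrt_pow_eq_rpow hsα.le,
            ENNReal.ofReal_rpow_of_nonneg (by positivity) hp0.le, ← ENNReal.ofReal_mul
            (by positivity), ← ENNReal.ofReal_mul (by positivity), Real.mul_rpow hA (by positivity),
            ← Real.rpow_mul hsα.le]
          congr 1
          -- Criticality: the height to the power `p` times the volume of the parabolic ball scales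
          -- exactly like `s ^ (-α)`.
          have e : s ^ (-α) = (s ^ α) ^ (-((N : ℝ) / 2) * p) * (s ^ α) ^ ((N : ℝ) / 2) := by
            rw [← Real.rpow_add hsα, show -((N : ℝ) / 2) * p + (N : ℝ) / 2 = -1 by linarith,
              Real.rpow_neg hs0.le, Real.rpow_neg_one]
          rw [e]; ring
      _ = ∫⁻ _ in Metric.closedBall (0 : Space N) √(s ^ α),
          ENNReal.ofReal (A * (s ^ α) ^ (-((N : ℝ) / 2))) ^ p * ENNReal.ofReal K :=
          (setLIntegral_const _ _).symm
      _ ≤ ∫⁻ y in Metric.closedBall (0 : Space N) √(s ^ α), u s y ^ p *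
          subordKernel (fun θ => ENNReal.ofReal (θ * wrightDensity α θ)) ((t - s) ^ α) (x - y) := by
          refine lintegral_mono_ae ?_
          exact (ae_restrict_iff' Metric.isClosed_closedBall.measurableSet).mpr hpt
      _ ≤ _ := setLIntegral_le_lintegral _ _
  refine le_trans ?_ (le_mildMap_of_le ht₀.le (by linarith : t / 2 ≤ t) ν hu hinner)
  set M := A ^ p * K * unitBallVolume N with hM
  have hM0 : 0 ≤ M := by positivity
  have hint : ENNReal.ofReal (t ^ (1 - α) / 4 / (1 - α))
      ≤ ∫⁻ s in Ioo t₀ (t / 2), ENNReal.ofReal (s ^ (-α)) := by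
    have hsplit : ∫⁻ s in Ioo 0 (t / 2), ENNReal.ofReal (s ^ (-α))
        ≤ (∫⁻ s in Ioo 0 t₀, ENNReal.ofReal (s ^ (-α))) +
          ∫⁻ s in Ioo t₀ (t / 2), ENNReal.ofReal (s ^ (-α)) := by
      have hsub : Ioo 0 (t / 2) ⊆ Ioo 0 t₀ ∪ ({t₀} ∪ Ioo t₀ (t / 2)) := by
        intro s hs
        rcases lt_trichotomy s t₀ with h | h | h
        · exact Or.inl ⟨hs.1, h⟩
        · exact Or.inr (Or.inl h)
        · exact Or.inr (Or.inr ⟨h, hs.2⟩)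
      refine (lintegral_mono_set hsub).trans ((lintegral_union_le _ _ _).trans ?_)
      refine add_le_add_right ((lintegral_union_le _ _ _).trans ?_) _
      rw [setLIntegral_measure_zero {t₀} _ (by simp), zero_add]
    rw [setLIntegral_rpow_Ioo (by linarith) (by positivity),
      setLIntegral_rpow_Ioo (by linarith) ht₀.le] at hsplit
    refine le_trans ?_ (tsub_le_iff_left.mpr hsplit)
    rw [← ENNReal.ofReal_sub _ (by rw [neg_add_eq_sub]; positivity)]
    refine ENNReal.ofReal_le_ofReal ?_
    rw [neg_add_eq_sub, ← sub_div]
    gcongr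
    -- The waiting factor `2 ^ (1 / (1 - α))` is chosen so that the missing part `(0, t₀)` takes at
    -- most half of the integral.
    have h5 : 2 * t₀ ^ (1 - α) ≤ (t / 2) ^ (1 - α) := by
      calc 2 * t₀ ^ (1 - α) = (2 ^ (1 / (1 - α)) * t₀) ^ (1 - α) := by
            rw [Real.mul_rpow (by positivity) ht₀.le, ← Real.rpow_mul (by norm_num),
              one_div_mul_cancel hβ.ne', Real.rpow_one]
        _ ≤ _ := Real.rpow_le_rpow (by positivity) hL hβ.le
    have h6 : t ^ (1 - α) ≤ 2 * (t / 2) ^ (1 - α) := by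
      calc t ^ (1 - α) = 2 ^ (1 - α) * (t / 2) ^ (1 - α) := by
            rw [← Real.mul_rpow (by norm_num) (by positivity)]; congr 1; ring
        _ ≤ 2 ^ (1 : ℝ) * (t / 2) ^ (1 - α) := by
            gcongr
            · norm_num
            · linarith
        _ = _ := by rw [Real.rpow_one]
    linarith
  calc _ ≤ ENNReal.ofReal α * (ENNReal.ofReal (t ^ (α - 1) * M) *
        ENNReal.ofReal (t ^ (1 - α) / 4 / (1 - α))) := by
        rw [← ENNReal.ofReal_mul (by positivity), ← ENNReal.ofReal_mul hα.le]
        refine ENNReal.ofReal_le_ofReal ?_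
        have e : t ^ (α - 1) * t ^ (1 - α) = 1 := by
          rw [← Real.rpow_add ht0]; simp
        have e2 : α * (t ^ (α - 1) * M * (t ^ (1 - α) / 4 / (1 - α)))
            = α * (M / 4 / (1 - α)) := by
          calc _ = (t ^ (α - 1) * t ^ (1 - α)) * (α * (M / 4 / (1 - α))) := by ring
            _ = _ := by rw [e, one_mul]
        rw [e2]
        calc _ = 1 / 2 * (M / 4 / (1 - α)) := by
              rw [hM, hK, gainConst]; ring
          _ ≤ _ := by gcongr
    _ ≤ ENNReal.ofReal α * (ENNReal.ofReal (t ^ (α - 1) * M) *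
        ∫⁻ s in Ioo t₀ (t / 2), ENNReal.ofReal (s ^ (-α))) := by gcongr
    _ = ENNReal.ofReal α * ∫⁻ s in Ioo t₀ (t / 2), ENNReal.ofReal (t ^ (α - 1) * M) *
        ENNReal.ofReal (s ^ (-α)) := by rw [lintegral_const_mul _ (by fun_prop)]
    _ ≤ _ := by
        refine mul_le_mul_right (setLIntegral_mono' measurableSet_Ioo fun s hs => ?_) _
        have hs0 : 0 < s := ht₀.trans hs.1
        rw [ENNReal.ofReal_mul (by positivity), ENNReal.ofReal_mul (p := M) hM0, mul_assoc]
        gcongr ENNReal.ofReal ?_ * _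
        exact Real.rpow_le_rpow_of_nonpos (by linarith [hs.2]) (by linarith) (by linarith)

/-- `hbig` says that one bootstrap step at least doubles `A`, and it persists as `A` grows because
`p > 1`. The starting times may grow without control. -/
theorem exists_parabolicLowerBound {α p : ℝ} (hα0 : 1 / 2 < α) (hα1 : α < 1)
    (hp : 1 < p) (hNp : (N : ℝ) / 2 * (p - 1) = 1)
    (hconc : ENNReal.ofReal (1 / 2) ≤
      ∫⁻ θ in Icc (1 / 2 : ℝ) (3 / 2), ENNReal.ofReal (wrightDensity α θ))
    {ν : Measure (Space N)} {u : ℝ → Space N → ℝ≥0∞}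
    (hu : Measurable fun z : ℝ × Space N => u z.1 z.2)
    (hsol : ∀ᵐ t : ℝ, 0 < t → ∀ᵐ x : Space N, u t x < ∞ ∧ u t x = mildMap α p ν u t x)
    {A t₀ : ℝ} (hA : 0 < A) (ht₀ : 0 < t₀) (hlow : ParabolicLowerBound α u A t₀)
    (hbig : 2 * (1 - α) ≤ gainConst N * A ^ (p - 1)) (n : ℕ) :
    ∃ T : ℝ, 0 < T ∧ ParabolicLowerBound α u (2 ^ n * A) T := by
  have hβ : 0 < 1 - α := by linarith
  have hg := gainConst_pos N
  induction n with
  | zero => exact ⟨t₀, ht₀, by simpa using hlow⟩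
  | succ n ih =>
    obtain ⟨T, hT, h⟩ := ih
    refine ⟨_, by positivity,
      (parabolicLowerBound_step hα0 hα1 hp hNp hconc hu hsol (by positivity) hT h).mono
        fun t ht htt => (ht htt).mono fun x hx hxt => le_trans (ENNReal.ofReal_le_ofReal ?_) (hx hxt)⟩
    have ht0 : 0 < t := lt_of_lt_of_le (by positivity) htt
    refine mul_le_mul_of_nonneg_right ?_ (by positivity)
    rw [le_div_iff₀ hβ]
    have e : (2 ^ n * A) ^ p = (2 ^ n * A) ^ (p - 1) * (2 ^ n * A) := by
      rw [← Real.rpow_add_one (by positivity), sub_add_cancel]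
    have h1 : A ^ (p - 1) ≤ (2 ^ n * A) ^ (p - 1) := by
      refine Real.rpow_le_rpow hA.le ?_ (by linarith)
      exact le_mul_of_one_le_left hA.le (one_le_pow₀ (by norm_num))
    rw [e]
    calc 2 ^ (n + 1) * A * (1 - α) = 2 * (1 - α) * (2 ^ n * A) := by ring
      _ ≤ gainConst N * A ^ (p - 1) * (2 ^ n * A) := by gcongr
      _ ≤ gainConst N * (2 ^ n * A) ^ (p - 1) * (2 ^ n * A) := by gcongr
      _ = _ := by ring

end Necessity

/-! ### Finite-time blow-up and the mass bound. -/

theorem exists_mem_of_measure_ne_zero_of_ae {X : Type*} [MeasurableSpace X] {μ : Measure X}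
    {s : Set X} (hs : μ s ≠ 0) {P : X → Prop} (hP : ∀ᵐ x ∂μ, P x) : ∃ x ∈ s, P x := by
  by_contra! h
  exact hs (measure_mono_null (fun x hx => h x hx) hP)

section BlowUp

variable {N : ℕ}

/-- The lower bound of the subordinated semigroup on the indicator of a ball. -/
noncomputable def ballConst (N : ℕ) : ℝ := kernelConst N 1 * (unitBallVolume N / 2 ^ N)

theorem ballConst_pos (N : ℕ) : 0 < ballConst N := by
  have := kernelConst_pos N 1
  have := unitBallVolume_pos N
  unfold ballConst; positivity

/-- Over the last `δ` units of time, diffusion from the ball of radius `T ^ (α / 2)` retains a fixed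
fraction at all its points, since `δ ≤ T`; the time kernel integrates to `δ ^ α`. The ball does not
shrink, so the step can be iterated. -/
theorem ball_lowerBound_step {α p : ℝ} (hα0 : 0 < α) (hp : 0 < p)
    (hconc : ENNReal.ofReal (1 / 2) ≤
      ∫⁻ θ in Icc (1 / 2 : ℝ) (3 / 2), ENNReal.ofReal (wrightDensity α θ))
    {ν : Measure (Space N)} {u : ℝ → Space N → ℝ≥0∞}
    (hu : Measurable fun z : ℝ × Space N => u z.1 z.2)
    (hsol : ∀ᵐ t : ℝ, 0 < t → ∀ᵐ x : Space N, u t x < ∞ ∧ u t x = mildMap α p ν u t x)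
    {T τ δ D b : ℝ} (hτ : 0 ≤ τ) (hδ : 0 < δ) (hδT : δ ≤ T) (hD : 0 ≤ D)
    (h : ∀ᵐ s : ℝ, s ∈ Icc τ b → ∀ᵐ y : Space N, ‖y‖ ≤ √(T ^ α) → ENNReal.ofReal D ≤ u s y) :
    ∀ᵐ t : ℝ, t ∈ Icc (τ + δ) b → ∀ᵐ x : Space N, ‖x‖ ≤ √(T ^ α) →
      ENNReal.ofReal (ballConst N * D ^ p * δ ^ α) ≤ u t x := by
  have hw : Measurable fun θ => ENNReal.ofReal (θ * wrightDensity α θ) :=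
    (measurable_id.mul (measurable_wrightDensity α)).ennreal_ofReal
  have hc := ballConst_pos N
  filter_upwards [hsol] with t ht htm
  filter_upwards [ht (by linarith [htm.1])] with x hx hxT
  rw [hx.2]
  have hinner : ∀ᵐ s : ℝ, s ∈ Ioo (t - δ) t →
      ENNReal.ofReal (ballConst N * D ^ p) ≤ ∫⁻ y, u s y ^ p *
      subordKernel (fun θ => ENNReal.ofReal (θ * wrightDensity α θ)) ((t - s) ^ α) (x - y) := by
    filter_upwards [h] with s hs hsm
    have hts : 0 < t - s := by linarith [hsm.2]
    have hs' := hs ⟨by linarith [htm.1, hsm.1], by linarith [htm.2, hsm.2]⟩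
    have hk : Measurable fun y : Space N =>
        subordKernel (fun θ => ENNReal.ofReal (θ * wrightDensity α θ)) ((t - s) ^ α) (x - y) :=
      (measurable_subordKernel hw).comp (f := fun y : Space N => ((t - s) ^ α, x - y))
        (by fun_prop)
    have hball := le_setLIntegral_subordKernel_closedBall (σ := (t - s) ^ α) (ρ := √(T ^ α))
      (by positivity) hw (quarter_le_lintegral_mul_wrightDensity hconc)
      (Real.sqrt_le_sqrt (Real.rpow_le_rpow hts.le (by linarith [hsm.1]) hα0.le)) hxT
    calc _ = ENNReal.ofReal D ^ p * ENNReal.ofReal (ballConst N) := by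
          rw [ENNReal.ofReal_rpow_of_nonneg hD hp.le, ← ENNReal.ofReal_mul (by positivity), mul_comm]
      _ ≤ ENNReal.ofReal D ^ p * ∫⁻ y in Metric.closedBall 0 √(T ^ α),
          subordKernel (fun θ => ENNReal.ofReal (θ * wrightDensity α θ)) ((t - s) ^ α) (x - y) :=
          mul_le_mul_right hball _
      _ = ∫⁻ y in Metric.closedBall 0 √(T ^ α), ENNReal.ofReal D ^ p *
          subordKernel (fun θ => ENNReal.ofReal (θ * wrightDensity α θ)) ((t - s) ^ α) (x - y) :=
          (lintegral_const_mul _ hk).symm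
      _ ≤ ∫⁻ y in Metric.closedBall 0 √(T ^ α), u s y ^ p *
          subordKernel (fun θ => ENNReal.ofReal (θ * wrightDensity α θ)) ((t - s) ^ α) (x - y) := by
          refine lintegral_mono_ae ?_
          refine (ae_restrict_iff' Metric.isClosed_closedBall.measurableSet).mpr ?_
          filter_upwards [hs'] with y hy hym
          rw [mem_closedBall_zero_iff] at hym
          exact mul_le_mul_left (ENNReal.rpow_le_rpow (hy hym) hp.le) _
      _ ≤ _ := setLIntegral_le_lintegral _ _
  refine le_trans (le_of_eq ?_)
    (le_mildMap_of_le (by linarith [htm.1]) le_rfl ν hu hinner)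
  rw [lintegral_mul_const _ (by fun_prop), setLIntegral_sub_rpow_Ioo (by linarith) (by linarith),
    sub_sub_cancel, sub_add_cancel, ← ENNReal.ofReal_mul (by positivity),
    ← ENNReal.ofReal_mul (by positivity)]
  congr 1
  field_simp

/-- A large parabolic lower bound forces finite-time blow-up. -/
theorem not_parabolicLowerBound {α p : ℝ} (hα0 : 0 < α) (hα1 : α < 1)
    (hp : 1 < p) (hNp : (N : ℝ) / 2 * (p - 1) = 1)
    (hconc : ENNReal.ofReal (1 / 2) ≤
      ∫⁻ θ in Icc (1 / 2 : ℝ) (3 / 2), ENNReal.ofReal (wrightDensity α θ))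
    {ν : Measure (Space N)} {u : ℝ → Space N → ℝ≥0∞}
    (hu : Measurable fun z : ℝ × Space N => u z.1 z.2)
    (hsol : ∀ᵐ t : ℝ, 0 < t → ∀ᵐ x : Space N, u t x < ∞ ∧ u t x = mildMap α p ν u t x)
    {A T : ℝ} (hA : 0 < A) (hT : 0 < T)
    (hbig : 8 * 2 ^ (1 / (p - 1)) ≤ ballConst N * A ^ (p - 1)) :
    ¬ ParabolicLowerBound α u A T := by
  intro hlow
  have hp0 : 0 < p := by linarith
  have hp1 : 0 < p - 1 := by linarith
  have hc := ballConst_pos N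
  -- With `r ^ (p - 1) = 2` the nonlinear gain `2 ^ n` at stage `n` compensates the shrinking step
  -- `δ = T / 2 ^ (n + 2)`. The remaining factor is at least `ballConst N * A ^ (p - 1) / 8`, hence
  -- the threshold `8 * r`.
  set r : ℝ := 2 ^ (1 / (p - 1)) with hr
  have hr1 : 1 < r := Real.one_lt_rpow (by norm_num) (by positivity)
  have hr0 : 0 < r := by linarith
  have hrp : r ^ (p - 1) = 2 := by
    rw [hr, ← Real.rpow_mul (by norm_num), one_div_mul_cancel hp1.ne', Real.rpow_one]
  set D := A * ((2 * T) ^ α) ^ (-((N : ℝ) / 2)) with hD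
  have hD0 : 0 < D := by positivity
  have hDp : D ^ (p - 1) = A ^ (p - 1) * ((2 * T) ^ α)⁻¹ := by
    rw [hD, Real.mul_rpow hA.le (by positivity), ← Real.rpow_mul (by positivity), neg_mul, hNp,
      Real.rpow_neg_one]
  have h2T : (2 * T) ^ α ≤ 2 * T ^ α := by
    rw [Real.mul_rpow (by norm_num) hT.le]
    gcongr
    calc (2 : ℝ) ^ α ≤ 2 ^ (1 : ℝ) := Real.rpow_le_rpow_of_exponent_le (by norm_num) hα1.le
      _ = 2 := Real.rpow_one _
  -- The left endpoints start at `T` and increase to `3T / 2`, so all bounds hold together on `[3T /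
  -- 2, 2T]`, where `D * r ^ n → ∞` contradicts finiteness.
  have claim : ∀ n : ℕ, ∀ᵐ t : ℝ, t ∈ Icc (T * (3 / 2 - (1 / 2) ^ (n + 1))) (2 * T) →
      ∀ᵐ x : Space N, ‖x‖ ≤ √(T ^ α) → ENNReal.ofReal (D * r ^ n) ≤ u t x := by
    intro n
    induction n with
    | zero =>
      filter_upwards [hlow] with t ht htm
      have hTt : T ≤ t := by have := htm.1; norm_num at this; linarith
      have ht0 : 0 < t := by linarith
      filter_upwards [ht hTt] with x hx hxT
      have hx2 : ‖x‖ ^ 2 ≤ t ^ α := by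
        calc ‖x‖ ^ 2 ≤ √(T ^ α) ^ 2 := by gcongr
          _ = T ^ α := Real.sq_sqrt (by positivity)
          _ ≤ t ^ α := Real.rpow_le_rpow hT.le hTt hα0.le
      refine le_trans (ENNReal.ofReal_le_ofReal ?_) (hx hx2)
      rw [pow_zero, mul_one, hD]
      refine mul_le_mul_of_nonneg_left ?_ hA.le
      refine Real.rpow_le_rpow_of_nonpos (by positivity) ?_ (by simp; positivity)
      exact Real.rpow_le_rpow ht0.le htm.2 hα0.le
    | succ n ih =>
      have hpow : ((1 : ℝ) / 2) ^ (n + 1) ≤ 1 := pow_le_one₀ (by norm_num) (by norm_num)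
      have hpow2 : ((1 : ℝ) / 2) ^ (n + 2) ≤ 1 := pow_le_one₀ (by norm_num) (by norm_num)
      have hstep := ball_lowerBound_step hα0 hp0 hconc hu hsol (T := T)
        (τ := T * (3 / 2 - (1 / 2) ^ (n + 1))) (δ := T * (1 / 2) ^ (n + 2)) (D := D * r ^ n)
        (mul_nonneg hT.le (by linarith)) (by positivity)
        (mul_le_of_le_one_right hT.le hpow2) (by positivity) ih
      have et : T * (3 / 2 - (1 / 2) ^ (n + 1)) + T * (1 / 2) ^ (n + 2)
          = T * (3 / 2 - (1 / 2) ^ (n + 1 + 1)) := by ring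
      rw [et] at hstep
      refine hstep.mono fun t ht htm => (ht htm).mono fun x hx hxT =>
        le_trans (ENNReal.ofReal_le_ofReal ?_) (hx hxT)
      have e1 : (D * r ^ n) ^ p = D ^ (p - 1) * 2 ^ n * (D * r ^ n) := by
        have : (D * r ^ n) ^ p = (D * r ^ n) ^ (p - 1) * (D * r ^ n) := by
          rw [← Real.rpow_add_one (by positivity), sub_add_cancel]
        rw [this, Real.mul_rpow hD0.le (by positivity), ← Real.rpow_natCast r n,
          ← Real.rpow_mul hr0.le, mul_comm (n : ℝ), Real.rpow_mul hr0.le, hrp, Real.rpow_natCast]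
      have e2 : T ^ α * (1 / 2) ^ (n + 2) ≤ (T * (1 / 2) ^ (n + 2)) ^ α := by
        rw [Real.mul_rpow hT.le (by positivity)]
        gcongr
        calc ((1 : ℝ) / 2) ^ (n + 2) = (((1 : ℝ) / 2) ^ (n + 2)) ^ (1 : ℝ) := (Real.rpow_one _).symm
          _ ≤ _ := Real.rpow_le_rpow_of_exponent_ge (by positivity) hpow2 hα1.le
      have e3 : (1 : ℝ) / 2 ≤ ((2 * T) ^ α)⁻¹ * T ^ α := by
        rw [← div_eq_inv_mul, div_le_div_iff₀ (by norm_num) (by positivity)]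
        linarith
      have e4 : (2 : ℝ) ^ n * (1 / 2) ^ (n + 2) = 1 / 4 := by
        rw [pow_add, ← mul_assoc, ← mul_pow]; norm_num
      calc D * r ^ (n + 1) = 8 * r * (1 / 8) * (D * r ^ n) := by ring
        _ ≤ ballConst N * A ^ (p - 1) * (1 / 8) * (D * r ^ n) := by gcongr
        _ = ballConst N * A ^ (p - 1) * (1 / 2) * (1 / 4) * (D * r ^ n) := by ring
        _ ≤ ballConst N * A ^ (p - 1) * (((2 * T) ^ α)⁻¹ * T ^ α) * (1 / 4) * (D * r ^ n) := by
          gcongr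
        _ = ballConst N * (D ^ (p - 1) * 2 ^ n * (D * r ^ n)) * (T ^ α * (1 / 2) ^ (n + 2)) := by
          rw [hDp, ← e4]; ring
        _ ≤ _ := by rw [e1]; gcongr
  obtain ⟨t, htm, ht, hts⟩ := exists_mem_of_measure_ne_zero_of_ae
    (μ := (volume : Measure ℝ)) (s := Icc (T * (3 / 2)) (2 * T))
    (by rw [Real.volume_Icc, ne_eq, ENNReal.ofReal_eq_zero, not_le]; linarith)
    ((ae_all_iff.mpr claim).and hsol)
  have ht' : ∀ n : ℕ, ∀ᵐ x : Space N, ‖x‖ ≤ √(T ^ α) → ENNReal.ofReal (D * r ^ n) ≤ u t x := by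
    intro n
    refine ht n ⟨le_trans ?_ htm.1, htm.2⟩
    gcongr
    have : (0 : ℝ) < (1 / 2) ^ (n + 1) := by positivity
    linarith
  have ht0 : 0 < t := lt_of_lt_of_le (by positivity) htm.1
  obtain ⟨x, hxm, hx, hxs⟩ := exists_mem_of_measure_ne_zero_of_ae
    (μ := (volume : Measure (Space N))) (s := Metric.closedBall 0 √(T ^ α))
    (Metric.measure_closedBall_pos _ _ (Real.sqrt_pos.mpr (by positivity))).ne'
    ((ae_all_iff.mpr ht').and (hts ht0))
  rw [mem_closedBall_zero_iff] at hxm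
  have htend : Tendsto (fun n : ℕ => D * r ^ n) atTop atTop :=
    (tendsto_pow_atTop_atTop_of_one_lt hr1).const_mul_atTop hD0
  obtain ⟨n, hn⟩ := (htend.eventually_gt_atTop (u t x).toReal).exists
  have h1 := hx n hxm
  rw [ENNReal.ofReal_le_iff_le_toReal hxs.1.ne] at h1
  linarith

/-- Global solutions have small initial mass. -/
theorem measure_univ_le_of_isGlobalSolution {α p : ℝ} (hα0 : 1 / 2 < α) (hα1 : α < 1)
    (hp : 1 < p) (hNp : (N : ℝ) / 2 * (p - 1) = 1)
    (hconc : ENNReal.ofReal (1 / 2) ≤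
      ∫⁻ θ in Icc (1 / 2 : ℝ) (3 / 2), ENNReal.ofReal (wrightDensity α θ))
    {ν : Measure (Space N)} [IsFiniteMeasure ν] {u : ℝ → Space N → ℝ≥0∞}
    (hsol : IsGlobalSolution α p ν u) {m : ℝ} (hm : 0 < m)
    (hbig : 2 * (1 - α) ≤ gainConst N * (kernelConst N 4 * m) ^ (p - 1)) :
    ν univ ≤ ENNReal.ofReal m := by
  by_contra! hlt
  have hα : 0 < α := by linarith
  have hu := (hsol 1 one_pos).1
  have hae := hsol.ae_eq_mildMap
  have hk := kernelConst_pos N 4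
  have hlim : Tendsto (fun n : ℕ => ν (Metric.closedBall 0 (n : ℝ))) atTop (𝓝 (ν univ)) := by
    have := tendsto_measure_iUnion_atTop (μ := ν)
      (s := fun n : ℕ => Metric.closedBall (0 : Space N) (n : ℝ))
      (fun a b hab => Metric.closedBall_subset_closedBall (by exact_mod_cast hab))
    rwa [Metric.iUnion_closedBall_nat] at this
  obtain ⟨n, hn⟩ := (hlim.eventually_const_lt hlt).exists
  -- The parabolic ball at this time contains the ball of radius `n`; the `+ 1` keeps the time
  -- positive when `n = 0`.
  have ht₀ : 0 < ((n : ℝ) ^ 2 + 1) ^ (1 / α) := by positivity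
  have hR : (n : ℝ) ^ 2 ≤ (((n : ℝ) ^ 2 + 1) ^ (1 / α)) ^ α := by
    rw [← Real.rpow_mul (by positivity), one_div_mul_cancel hα.ne', Real.rpow_one]
    linarith
  have hlow := parabolicLowerBound_of_measure hα hconc hae hR ht₀ hn.le
  have hp1 : 0 < p - 1 := by linarith
  have htend : Tendsto (fun k : ℕ => ballConst N * (2 ^ k * (kernelConst N 4 * m)) ^ (p - 1))
      atTop atTop := by
    refine Tendsto.const_mul_atTop (ballConst_pos N) ((tendsto_rpow_atTop hp1).comp ?_)
    exact (tendsto_pow_atTop_atTop_of_one_lt (by norm_num)).atTop_mul_const (by positivity)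
  obtain ⟨k, hkb⟩ := (htend.eventually_ge_atTop (8 * 2 ^ (1 / (p - 1)))).exists
  obtain ⟨T, hT, hlowT⟩ := exists_parabolicLowerBound hα0 hα1 hp hNp hconc hu hae
    (by positivity) ht₀ hlow hbig k
  exact not_parabolicLowerBound hα hα1 hp hNp hconc hu hae (by positivity) hT hkb hlowT

end BlowUp

/-! ### Matching constants at the scale `(1 - α) ^ (N / 2)`. -/

section Threshold

variable {N : ℕ}

/-- The exponent `N / 2` in the theorem is `1 / (p - 1)`: both smallness and largeness conditions
compare `m ^ (p - 1)` with `1 - α`. -/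
theorem threshold_rpow {p : ℝ} (hNp : (N : ℝ) / 2 * (p - 1) = 1) {c β : ℝ} (hc : 0 ≤ c)
    (hβ : 0 ≤ β) : (c * β ^ ((N : ℝ) / 2)) ^ (p - 1) = c ^ (p - 1) * β := by
  rw [Real.mul_rpow hc (by positivity), ← Real.rpow_mul hβ, hNp, Real.rpow_one]

theorem exists_posBall_subset_globalData {p : ℝ} (hp : 1 < p)
    (hNp : (N : ℝ) / 2 * (p - 1) = 1) :
    ∃ C₁ : ℝ, 0 < C₁ ∧ ∀ᶠ α : ℝ in 𝓝[<] 1,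
      posBall N (C₁ * (1 - α) ^ ((N : ℝ) / 2)) ⊆ globalData N α p := by
  have hp0 : 0 < p := by linarith
  have hp1 : 0 < p - 1 := by linarith
  have hip : 1 / p < 1 := by rw [div_lt_one hp0]; exact hp
  have hip' : 0 < 1 - 1 / p := by linarith
  obtain ⟨C, hC, hmom⟩ := exists_wrightDensity_moment_bound (γ := 1 / p) (by positivity) hip
  set K : ℝ := 2 * (1 + 1 / (1 / 2 * (1 - 1 / p))) with hK
  have hK0 : 0 < K := by positivity
  set Q : ℝ := (2 * C) ^ p * K with hQ
  have hQ0 : 0 < Q := by positivity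
  -- This makes `Q * m ^ (p - 1) = 1 - α`, the equality case of the smallness condition after `α` in
  -- the Beta constant is replaced by its lower bound `1 / 2`.
  refine ⟨Q⁻¹ ^ (1 / (p - 1)), by positivity, ?_⟩
  filter_upwards [eventually_Ioo_half_one, hmom] with α hα hM μ hμ
  have hβ : 0 < 1 - α := by linarith [hα.2]
  have hα0 : 0 < α := by linarith [hα.1]
  have := hμ.1
  set m := Q⁻¹ ^ (1 / (p - 1)) * (1 - α) ^ ((N : ℝ) / 2) with hm
  have hm0 : 0 < m := by positivity
  have hmp : m ^ (p - 1) = Q⁻¹ * (1 - α) := by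
    rw [hm, threshold_rpow hNp (by positivity) hβ.le, ← Real.rpow_mul (by positivity),
      one_div_mul_cancel hp1.ne', Real.rpow_one]
  refine ⟨hμ.1, exists_isGlobalSolution hp hNp hα0 hα.2 hC hm0.le hM.1 hM.2 ?_ μ hμ.2⟩
  have h1 : 2 * (1 + 1 / (α * (1 - 1 / p))) ≤ K := by
    rw [hK]
    gcongr
    exact hα.1.le
  calc (2 * m * C) ^ p * (2 * (1 + 1 / (α * (1 - 1 / p))) / (1 - α))
      ≤ (2 * m * C) ^ p * (K / (1 - α)) := by gcongr
    _ = Q * (m ^ (p - 1) * m) / (1 - α) := by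
        rw [← Real.rpow_add_one hm0.ne', sub_add_cancel, show 2 * m * C = 2 * C * m by ring,
          Real.mul_rpow (by positivity) hm0.le, hQ]
        ring
    _ = m := by
        rw [hmp]; field_simp

theorem exists_globalData_subset_posBall {p : ℝ} (hp : 1 < p)
    (hNp : (N : ℝ) / 2 * (p - 1) = 1) :
    ∃ C₂ : ℝ, 0 < C₂ ∧ ∀ᶠ α : ℝ in 𝓝[<] 1,
      globalData N α p ⊆ posBall N (C₂ * (1 - α) ^ ((N : ℝ) / 2)) := by
  have hp1 : 0 < p - 1 := by linarith
  have hg := gainConst_pos N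
  have hk := kernelConst_pos N 4
  -- Solves the doubling condition `2 * (1 - α) ≤ gainConst N * (kernelConst N 4 * m) ^ (p - 1)`
  -- with equality.
  refine ⟨(2 / gainConst N) ^ (1 / (p - 1)) / kernelConst N 4, by positivity, ?_⟩
  filter_upwards [eventually_Ioo_half_one, eventually_half_le_lintegral_wrightDensity]
    with α hα hconc ν hν
  have hβ : 0 < 1 - α := by linarith [hα.2]
  obtain ⟨hfin, u, hu⟩ := hν
  refine ⟨hfin, measure_univ_le_of_isGlobalSolution hα.1 hα.2 hp hNp hconc hu (by positivity) ?_⟩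
  have e : kernelConst N 4 * ((2 / gainConst N) ^ (1 / (p - 1)) / kernelConst N 4 *
      (1 - α) ^ ((N : ℝ) / 2)) = (2 / gainConst N) ^ (1 / (p - 1)) * (1 - α) ^ ((N : ℝ) / 2) := by
    field_simp
  rw [e, threshold_rpow hNp (by positivity) hβ.le, ← Real.rpow_mul (by positivity),
    one_div_mul_cancel hp1.ne', Real.rpow_one]
  refine le_of_eq ?_
  field_simp

theorem posBall_mono {r s : ℝ} (h : r ≤ s) : posBall N r ⊆ posBall N s :=
  fun _ hμ => ⟨hμ.1, hμ.2.trans (ENNReal.ofReal_le_ofReal h)⟩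

/-- A point mass at the origin attains the full mass allowed in the ball. -/
theorem le_iSup_measure_univ_of_posBall_subset {r : ℝ} {S : Set (Measure (Space N))}
    (h : posBall N r ⊆ S) : ENNReal.ofReal r ≤ ⨆ ν ∈ S, ν univ := by
  have hmass : (ENNReal.ofReal r • Measure.dirac (0 : Space N)) univ = ENNReal.ofReal r := by simp
  have hfin : IsFiniteMeasure (ENNReal.ofReal r • Measure.dirac (0 : Space N)) :=
    ⟨by rw [hmass]; exact ENNReal.ofReal_lt_top⟩
  refine le_iSup₂_of_le (ENNReal.ofReal r • Measure.dirac (0 : Space N)) (h ⟨hfin, hmass.le⟩) ?_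
  exact hmass.ge

end Threshold

end TimeFracHeat

theorem theorem4p1 (N : ℕ) (hN : 1 ≤ N) (p : ℝ) (hp : p = TimeFracHeat.fujitaExponent N) :
    ∃ C₁ C₂ : ℝ, 0 < C₁ ∧ C₁ ≤ C₂ ∧
      (∀ᶠ α : ℝ in 𝓝[<] 1,
        TimeFracHeat.posBall N (C₁ * (1 - α) ^ ((N : ℝ) / 2)) ⊆ TimeFracHeat.globalData N α p ∧
        TimeFracHeat.globalData N α p ⊆ TimeFracHeat.posBall N (C₂ * (1 - α) ^ ((N : ℝ) / 2))) ∧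
      (∀ᶠ α : ℝ in 𝓝[<] 1,
        ENNReal.ofReal (C₁ * (1 - α) ^ ((N : ℝ) / 2)) ≤
            (⨆ ν ∈ TimeFracHeat.globalData N α p, ν univ) ∧
        (⨆ ν ∈ TimeFracHeat.globalData N α p, ν univ) ≤
            ENNReal.ofReal (C₂ * (1 - α) ^ ((N : ℝ) / 2))) ∧
      Tendsto (fun α : ℝ => ⨆ ν ∈ TimeFracHeat.globalData N α p, ν univ) (𝓝[<] 1) (𝓝 0) := by

  have hN0 : (0 : ℝ) < N := by exact_mod_cast hN
  have hp1 : 1 < p := by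
    rw [hp, TimeFracHeat.fujitaExponent]
    have : 0 < 2 / (N : ℝ) := by positivity
    linarith
  have hNp : (N : ℝ) / 2 * (p - 1) = 1 := by
    rw [hp, TimeFracHeat.fujitaExponent]
    field_simp
    ring
  obtain ⟨C₁, hC₁, h₁⟩ := TimeFracHeat.exists_posBall_subset_globalData hp1 hNp
  obtain ⟨C₂, hC₂, h₂⟩ := TimeFracHeat.exists_globalData_subset_posBall hp1 hNp
  have hincl : ∀ᶠ α : ℝ in 𝓝[<] 1,
      TimeFracHeat.posBall N (C₁ * (1 - α) ^ ((N : ℝ) / 2)) ⊆ TimeFracHeat.globalData N α p ∧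
      TimeFracHeat.globalData N α p ⊆
        TimeFracHeat.posBall N (max C₁ C₂ * (1 - α) ^ ((N : ℝ) / 2)) := by
    filter_upwards [h₁, h₂, TimeFracHeat.eventually_Ioo_half_one] with α ha hb hα
    refine ⟨ha, hb.trans (TimeFracHeat.posBall_mono ?_)⟩
    have : 0 ≤ 1 - α := by linarith [hα.2]
    gcongr
    exact le_max_right _ _
  have hsup : ∀ᶠ α : ℝ in 𝓝[<] 1,
      ENNReal.ofReal (C₁ * (1 - α) ^ ((N : ℝ) / 2)) ≤
          (⨆ ν ∈ TimeFracHeat.globalData N α p, ν univ) ∧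
      (⨆ ν ∈ TimeFracHeat.globalData N α p, ν univ) ≤
          ENNReal.ofReal (max C₁ C₂ * (1 - α) ^ ((N : ℝ) / 2)) := by
    filter_upwards [hincl] with α hα
    exact ⟨TimeFracHeat.le_iSup_measure_univ_of_posBall_subset hα.1,
      iSup₂_le fun ν hν => (hα.2 hν).2⟩
  refine ⟨C₁, max C₁ C₂, hC₁, le_max_left _ _, hincl, hsup, ?_⟩
  have hlim : Tendsto (fun α : ℝ => ENNReal.ofReal (max C₁ C₂ * (1 - α) ^ ((N : ℝ) / 2)))
      (𝓝[<] 1) (𝓝 0) := by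
    have hc : Continuous fun α : ℝ => max C₁ C₂ * (1 - α) ^ ((N : ℝ) / 2) :=
      continuous_const.mul ((continuous_const.sub continuous_id).rpow_const
        fun _ => Or.inr (by positivity))
    have h := (ENNReal.continuous_ofReal.comp hc).tendsto 1
    have h0 : ((0 : ℝ)) ^ ((N : ℝ) / 2) = 0 := Real.zero_rpow (by positivity)
    simp only [Function.comp_apply, sub_self, h0, mul_zero, ENNReal.ofReal_zero] at h
    exact h.mono_left nhdsWithin_le_nhds
  exact tendsto_of_tendsto_of_tendsto_of_le_of_le' tendsto_const_nhds hlim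
    (Eventually.of_forall fun _ => zero_le) (hsup.mono fun _ h => h.2)
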